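/- For $p\in[0,1]$ let $\mu_p$ be the Bernoulli measure on $2^\omega$, i.e. $\mu_p(\llbracket\sigma\rrbracket)=p^{\#_0(\sigma)}(1-p)^{\#_1(\sigma)}$ for every finite binary string $\sigma$, where $\#_i(\sigma)$ is the number of occurrences of $i$ in $\sigma$. Let $\mathsf{MLR}_{\mu_p}$ be the set of all $x\in 2^\omega$ that are Martin-Löf random with respect to $\mu_p$ relative to the oracle $p$ (given by its binary expansion): $x\notin\bigcap_i\mathcal U_i$ for every sequence $(\mathcal U_i)_{i\in\omega}$ of uniformly $\Sigma^{0,p}_1$ subsets of $2^\omega$ with $\mu_p(\mathcal U_i)\le 2^{-i}$ for all $i$. A sequence $x\in2^\omega$ is called proper if it is Martin-Löf random (with no oracle) with respect to some computable probability measure on $2^\omega$, and a real $p\in[0,1]$ is called proper if it is Martin-Löf random with respect to some computable probability measure on $[0,1]$, where a measure on $[0,1]$ is computable if the measures of finite unions of rational open intervals are uniformly lower semicomputable, and tests on $[0,1]$ are uniformly effective unions of rational open intervals. Corollary 3.6. For every $p\in[0,1]$ and every $x\in\mathsf{MLR}_{\mu_p}$, the sequence $x$ is proper if and only if $p$ is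 proper. -/

import Mathlib

namespace AlgRandom

open MeasureTheory

/-- A predicate is recursively enumerable relative to the oracles in `O` if it is the domain of a
partial function that is recursive in `O`. For `O = ∅` this is `REPred`. -/
def REPredIn {α : Type*} [Primcodable α] (O : Set (ℕ →. ℕ)) (P : α → Prop) : Prop :=
  RecursiveIn O fun a => Part.assert (P a) fun _ => Part.some ()

theorem rePredIn_empty_iff {α : Type*} [Primcodable α] (P : α → Prop) :
    REPredIn ∅ P ↔ REPred P :=
  recursiveIn_empty_iff

/-- `U` is a uniformly effectively open (`Σ⁰₁` relative to the oracles in `O`) sequence of subsets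
of `X`, with respect to the coded family `B` of basic open sets: for an r.e. set `W` of pairs,
`U i` is the union of all `B c` with `(i, c) ∈ W`. -/
def UniformlyEffectivelyOpen {X C : Type*} [Primcodable C] (B : C → Set X) (O : Set (ℕ →. ℕ))
    (U : ℕ → Set X) : Prop :=
  ∃ W : ℕ × C → Prop, REPredIn O W ∧ ∀ i, U i = {t | ∃ c, W (i, c) ∧ t ∈ B c}

/-- A Martin-Löf test for `μ`, relative to the oracles in `O`. -/
def IsMLTest {X C : Type*} [MeasurableSpace X] [Primcodable C] (B : C → Set X)
    (O : Set (ℕ →. ℕ)) (μ : Measure X) (U : ℕ → Set X) : Prop :=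
  UniformlyEffectivelyOpen B O U ∧ ∀ i, μ (U i) ≤ (2⁻¹ : ENNReal) ^ i

/-- The Martin-Löf random points for `μ` relative to the oracles in `O`: those that pass every
Martin-Löf test. -/
def MLR {X C : Type*} [MeasurableSpace X] [Primcodable C] (B : C → Set X)
    (O : Set (ℕ →. ℕ)) (μ : Measure X) : Set X :=
  {t | ∀ U : ℕ → Set X, IsMLTest B O μ U → t ∉ ⋂ i, U i}

/-! ### Cantor space; `false` is the symbol 0 and `true` is the symbol 1 -/

/-- The basic clopen set of all infinite sequences that extend the string `σ`. -/
def basicClopen (σ : List Bool) : Set (ℕ → Bool) :=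
  {x | ∀ (i : ℕ) (h : i < σ.length), x i = σ[i]}

/-- A measure on Cantor space is computable if `μ ⟦σ⟧` is a computable real uniformly in `σ`:
a computable function gives, on input `σ` and `n`, the numerator of a dyadic rational
with denominator `2 ^ n` within `2 ^ (-n)` of `μ ⟦σ⟧`. -/
def IsComputableMeasure (μ : Measure (ℕ → Bool)) : Prop :=
  ∃ f : List Bool → ℕ → ℕ, Computable₂ f ∧
    ∀ σ n, |μ.real (basicClopen σ) - (f σ n : ℝ) / 2 ^ n| ≤ 1 / 2 ^ n

/-- A sequence is proper if it is Martin-Löf random for some computable probability measure. -/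
def IsProperSeq (x : ℕ → Bool) : Prop :=
  ∃ μ : Measure (ℕ → Bool), IsProbabilityMeasure μ ∧ IsComputableMeasure μ ∧
    x ∈ MLR basicClopen ∅ μ

/-! ### The unit interval as a computable metric space -/

/-- The rational ball in `[0,1]` coded by `(a, r, d)`: centre `a / (d+1)`, radius `r / (d+1)`.
Every rational open interval of `[0,1]` is of this form. -/
def ratBall (c : ℕ × ℕ × ℕ) : Set unitInterval :=
  {t | |(t : ℝ) - (c.1 : ℝ) / ((c.2.2 : ℝ) + 1)| < (c.2.1 : ℝ) / ((c.2.2 : ℝ) + 1)}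

/-- A measure on `[0,1]` is computable if the measures of finite unions of rational balls are
uniformly lower semicomputable: the set of all `(L, (k, m))` with
`k / (m+1) < ν (⋃ c ∈ L, ratBall c)` is recursively enumerable. -/
def IsComputableMeasureUnit (ν : Measure unitInterval) : Prop :=
  REPred fun q : List (ℕ × ℕ × ℕ) × (ℕ × ℕ) =>
    (q.2.1 : ℝ) / ((q.2.2 : ℝ) + 1) < ν.real {t | ∃ c ∈ q.1, t ∈ ratBall c}

/-- A real in `[0,1]` is proper if it is Martin-Löf random for some computable probability measure
on `[0,1]`. -/
def IsProperReal (p : unitInterval) : Prop :=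
  ∃ ν : Measure unitInterval, IsProbabilityMeasure ν ∧ IsComputableMeasureUnit ν ∧
    p ∈ MLR ratBall ∅ ν

/-! ### Bernoulli randomness -/

/-- The Bernoulli measure `μ_p`: the coordinates are independent, and each is the symbol 0 with
probability `p` and the symbol 1 with probability `1 - p`. -/
noncomputable def bernoulliMu (p : unitInterval) : Measure (ℕ → Bool) :=
  Measure.infinitePi fun _ => ProbabilityTheory.bernoulliMeasure false true p

/-- The binary expansion of `p` as an oracle. (For `p = 1` all digits are 0; this oracle is
computable, as is the other expansion.) -/
noncomputable def binaryExpansion (p : unitInterval) : ℕ →. ℕ :=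
  fun n => Part.some (⌊(p : ℝ) * 2 ^ (n + 1)⌋₊ % 2)

/-- The Bernoulli `p`-random sequences: those that pass every `μ_p`-test relative to `p`. -/
def bernoulliMLR (p : unitInterval) : Set (ℕ → Bool) :=
  MLR basicClopen {binaryExpansion p} (bernoulliMu p)

end AlgRandom

/-! The parameter `p` and the sequence `x` determine each other up to computable operations on
measures, so randomness for a computable measure passes between them. In both directions it is
enough that `x` passes the `μ_p`-tests that use no oracle.

From `p` to `x`: let `p` be random for a computable `ν`. The mixture `∫ μ_q dν(q)` is a computable
measure. If a test `U` for it captured `x`, the sets of `q` with `μ_q (U (2i)) > 2^(-i)` would be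
effectively open, and by Markov's inequality of `ν`-measure at most `2^(-i)`. Hence `p` lies in only
finitely many of them, a tail of `U (2i)` is a `μ_p`-test, and it captures `x`, a contradiction
(`mem_MLR_bernoulliMixture`).

From `x` to `p`: let `x` be random for a computable `μ`. By Chebyshev's inequality, the frequencies
of zeros among the first `8^k` bits of `x` converge to `p`, and from some `K` on consecutive
frequencies differ by at most `2 / 2^k`. Overriding every larger jump gives a map `clampLimit K`
that is defined and effectively continuous on all of Cantor space and sends `x` to `p`
(`exists_clampLimit_eq`). The image of `μ` under it is computable, and `p` is random for the image
because preimages of tests are tests (`clampLimit_mem_MLR`). -/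

/-! ### Recursively enumerable predicates -/

section RE

variable {α β γ : Type*} [Primcodable α] [Primcodable β] [Primcodable γ]

theorem rePred_of_primrecRel {P : α → Prop} {R : α → γ → Prop} (hR : PrimrecRel R)
    (h : ∀ a, P a ↔ ∃ c, R a c) : REPred P := by
  classical
  have hg : Primrec₂ fun (a : α) (n : ℕ) =>
      (Encodable.decode (α := γ) n).elim false fun c => decide (R a c) := by
    refine (Primrec.option_casesOn (o := fun q : α × ℕ => Encodable.decode (α := γ) q.2)
      (f := fun _ => false) (g := fun q c => decide (R q.1 c))
      (Primrec.decode.comp Primrec.snd) (Primrec.const false) ?_).of_eq ?_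
    · exact hR.decide.comp (Primrec.fst.comp Primrec.fst) Primrec.snd
    · rintro ⟨a, n⟩
      cases h : Encodable.decode (α := γ) n <;> simp [h]
  refine (Partrec.rfind (p := fun a n =>
    Part.some ((Encodable.decode (α := γ) n).elim false fun c => decide (R a c)))
    hg.to_comp.partrec₂).dom_re.of_eq fun a => ?_
  refine Nat.rfind_dom'.trans ?_
  simp only [Part.mem_some_iff, Part.some_dom, implies_true, and_true]
  rw [h a]
  constructor
  · rintro ⟨n, hn⟩
    cases hd : Encodable.decode (α := γ) n with
    | none => simp [hd] at hn
    | some c => exact ⟨c, by simpa [hd] using hn⟩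
  · rintro ⟨c, hc⟩
    exact ⟨Encodable.encode c, by simpa using hc⟩

/-- Step-bounded evaluation is primitive recursive. With the converse above, this is a normal form
that reduces the closure properties below to packing witnesses into one search, with no dovetailing
of computations. -/
theorem REPred.exists_primrecRel {P : α → Prop} (hP : REPred P) :
    ∃ R : α → ℕ → Prop, PrimrecRel R ∧ ∀ a, P a ↔ ∃ n, R a n := by
  obtain ⟨c, hc⟩ := Nat.Partrec.Code.exists_code.1 hP
  refine ⟨fun a n => (Nat.Partrec.Code.evaln n c (Encodable.encode a)).isSome = true, ?_, ?_⟩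
  · have h1 : Primrec fun q : α × ℕ => (Nat.Partrec.Code.evaln q.2 c (Encodable.encode q.1)).isSome :=
      Primrec.option_isSome.comp (Nat.Partrec.Code.primrec_evaln.comp
        ((Primrec.snd.pair (Primrec.const c)).pair (Primrec.encode.comp Primrec.fst)))
    exact (Primrec.eq.comp h1 (Primrec.const true)).primrecRel
  · intro a
    have h1 := congrFun hc (Encodable.encode a)
    have h2 : P a ↔ (Nat.Partrec.Code.eval c (Encodable.encode a)).Dom := by
      rw [h1]; simp [Part.assert]
    rw [h2]
    constructor
    · intro h
      obtain ⟨k, hk⟩ := Nat.Partrec.Code.evaln_complete.1 (Part.get_mem h)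
      exact ⟨k, Option.isSome_iff_exists.2 ⟨_, hk⟩⟩
    · rintro ⟨n, hn⟩
      obtain ⟨v, hv⟩ := Option.isSome_iff_exists.1 hn
      exact Part.dom_iff_mem.2 ⟨v, Nat.Partrec.Code.evaln_sound hv⟩

protected theorem REPred.comp {P : β → Prop} (hP : REPred P) {f : α → β} (hf : Computable f) :
    REPred fun a => P (f a) :=
  Partrec.comp hP hf

protected theorem REPred.exists {P : α × β → Prop} (hP : REPred P) : REPred fun a => ∃ b, P (a, b) := by
  obtain ⟨R, hR, h⟩ := hP.exists_primrecRel
  refine rePred_of_primrecRel (R := fun a (c : β × ℕ) => R (a, c.1) c.2) ?_ fun a => ?_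
  · exact hR.comp (Primrec.fst.pair (Primrec.fst.comp Primrec.snd))
      (Primrec.snd.comp Primrec.snd)
  · simp [h]

protected theorem REPred.and {P Q : α → Prop} (hP : REPred P) (hQ : REPred Q) :
    REPred fun a => P a ∧ Q a := by
  obtain ⟨R, hR, h⟩ := hP.exists_primrecRel
  obtain ⟨S, hS, h'⟩ := hQ.exists_primrecRel
  refine rePred_of_primrecRel (R := fun a (c : ℕ × ℕ) => R a c.1 ∧ S a c.2) ?_ fun a => ?_
  · exact (PrimrecPred.and (hR.comp Primrec.fst (Primrec.fst.comp Primrec.snd))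
      (hS.comp Primrec.fst (Primrec.snd.comp Primrec.snd))).primrecRel
  · simp [h, h']

protected theorem REPred.or {P Q : α → Prop} (hP : REPred P) (hQ : REPred Q) :
    REPred fun a => P a ∨ Q a := by
  obtain ⟨R, hR, h⟩ := hP.exists_primrecRel
  obtain ⟨S, hS, h'⟩ := hQ.exists_primrecRel
  refine rePred_of_primrecRel (R := fun a (n : ℕ) => R a n ∨ S a n) ?_ fun a => ?_
  · exact PrimrecPred.or hR hS
  · simp [h, h', exists_or]

theorem REPred.forall_mem {P : α × β → Prop} (hP : REPred P) {f : α → List β}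
    (hf : Computable f) : REPred fun a => ∀ b ∈ f a, P (a, b) := by
  obtain ⟨R, hR, h⟩ := hP.exists_primrecRel
  have key : REPred fun q : List β × α => ∀ b ∈ q.1, P (q.2, b) := by
    refine rePred_of_primrecRel
      (R := fun (q : List β × α) (N : ℕ) => ∀ b ∈ q.1, ∃ n < N, R (q.2, b) n) ?_ ?_
    · have h1 : PrimrecRel fun (N : ℕ) (q : α × β) => ∃ n < N, R q n :=
        ((PrimrecRel.exists_mem_list (R := fun (n : ℕ) (q : α × β) => R q n) hR.swap).comp
          (Primrec.list_range.comp Primrec.fst) Primrec.snd).primrecRel.of_eq fun N q => by simp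
      have h2 : PrimrecRel fun (b : β) (q : α × ℕ) => ∃ n < q.2, R (q.1, b) n :=
        h1.comp (Primrec.snd.comp Primrec.snd) ((Primrec.fst.comp Primrec.snd).pair Primrec.fst)
      have h3 := h2.forall_mem_list
      exact h3.comp (Primrec.fst.comp Primrec.fst) ((Primrec.snd.comp Primrec.fst).pair Primrec.snd)
    · rintro ⟨L, a⟩
      simp only [h]
      constructor
      · intro H
        choose! g hg using H
        -- A list is finite, so one bound serves all its members; the sum dominates each single
        -- witness.
        refine ⟨(L.map g).sum + 1, fun b hb => ⟨g b, ?_, hg b hb⟩⟩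
        exact Nat.lt_succ_of_le (List.single_le_sum (by simp) _ (List.mem_map_of_mem hb))
      · rintro ⟨N, H⟩ b hb
        obtain ⟨n, -, hn⟩ := H b hb
        exact ⟨n, hn⟩
  exact key.comp (hf.pair Computable.id)

theorem REPred.exists_computable_choice {P : α × β → Prop} (hP : REPred P)
    (h : ∀ a, ∃ b, P (a, b)) : ∃ f : α → β, Computable f ∧ ∀ a, P (a, f a) := by
  classical
  obtain ⟨R, hR, h'⟩ := hP.exists_primrecRel
  -- The search runs over codes of pairs of a value and a witness for it, and returns the value of
  -- the first pair that checks.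
  let g : α → ℕ → Option β := fun a n =>
    (Encodable.decode (α := β × ℕ) n).bind fun c => if R (a, c.1) c.2 then some c.1 else none
  have hg : Primrec₂ g := by
    refine Primrec.option_bind (f := fun q : α × ℕ => Encodable.decode (α := β × ℕ) q.2)
      (g := fun q c => if R (q.1, c.1) c.2 then some c.1 else none)
      (Primrec.decode.comp Primrec.snd) ?_
    refine Primrec.ite ?_ (Primrec.option_some.comp (Primrec.fst.comp Primrec.snd))
      (Primrec.const none)
    exact hR.comp ((Primrec.fst.comp Primrec.fst).pair (Primrec.fst.comp Primrec.snd))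
      (Primrec.snd.comp Primrec.snd)
  have hd : ∀ a, (Nat.rfindOpt (g a)).Dom := by
    intro a
    obtain ⟨b, hb⟩ := h a
    obtain ⟨n, hn⟩ := (h' _).1 hb
    exact Nat.rfindOpt_dom.2 ⟨Encodable.encode (b, n), b, by simp [g, hn]⟩
  refine ⟨fun a => (Nat.rfindOpt (g a)).get (hd a), ?_, fun a => ?_⟩
  · exact (Partrec.rfindOpt hg.to_comp).of_eq_tot fun a => Part.get_mem _
  · obtain ⟨n, hn⟩ := Nat.rfindOpt_spec (Part.get_mem (hd a))
    simp only [g, Option.mem_def, Option.bind_eq_some_iff] at hn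
    obtain ⟨c, -, hc⟩ := hn
    split_ifs at hc with hR'
    rw [Option.some.injEq] at hc
    have h3 := (h' _).2 ⟨_, hR'⟩
    rw [hc] at h3
    exact h3

theorem primrec_nat_pow : Primrec₂ ((· ^ ·) : ℕ → ℕ → ℕ) :=
  Primrec₂.unpaired'.1 Nat.Primrec.pow

theorem primrecPred_nodup : PrimrecPred fun L : List α => L.Nodup := by
  classical
  have hmem : PrimrecRel fun (L : List α) (a : α) => ∃ b ∈ L, b = a :=
    PrimrecRel.exists_mem_list Primrec.eq
  refine Primrec.primrecPred ((Primrec.list_rec (f := fun L : List α => L)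
    (g := fun _ => true) (h := fun _ q => !(decide (∃ b ∈ q.2.1, b = q.1)) && q.2.2)
    Primrec.id (Primrec.const true) ?_).of_eq fun L => ?_)
  · refine Primrec.and.comp (Primrec.not.comp ?_)
      (Primrec.snd.comp (Primrec.snd.comp Primrec.snd))
    exact hmem.decide.comp (Primrec.fst.comp (Primrec.snd.comp Primrec.snd))
      (Primrec.fst.comp Primrec.snd)
  · induction L with
    | nil => simp
    | cons a L ih => simp only [] at ih ⊢; rw [ih]; simp [List.nodup_cons]

theorem primrecRel_isPrefix : PrimrecRel fun σ τ : List α => σ <+: τ := by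
  refine (Primrec.eq.comp (Primrec.fst (α := List α) (β := List α)) ?_ :
    PrimrecPred fun q : List α × List α => q.1 = q.2.take q.1.length).of_eq ?_
  · exact Primrec.list_take.comp (Primrec.list_length.comp Primrec.fst) Primrec.snd
  · rintro ⟨σ, τ⟩
    exact List.prefix_iff_eq_take.symm

theorem primrec_list_sum : Primrec (List.sum : List ℕ → ℕ) :=
  (Primrec.list_foldr (f := fun L : List ℕ => L) (g := fun _ => 0) (h := fun _ q => q.1 + q.2)
    Primrec.id (Primrec.const 0) (Primrec.nat_add.comp (Primrec.fst.comp Primrec.snd)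
      (Primrec.snd.comp Primrec.snd))).of_eq fun L => by
        induction L <;> simp_all

end RE

/-! ### Lower semicomputable functions -/

namespace AlgRandom

open MeasureTheory Filter Topology ProbabilityTheory

attribute [local irreducible] REPred

variable {α β : Type*} [Primcodable α] [Primcodable β]

/-- A real-valued function is lower semicomputable if the nonnegative rationals below its values
are uniformly recursively enumerable. -/
def LowerSemicomputable (F : α → ℝ) : Prop :=
  REPred fun q : α × ℕ × ℕ => (q.2.1 : ℝ) / ((q.2.2 : ℝ) + 1) < F q.1

namespace LowerSemicomputable

protected theorem comp {F : β → ℝ} (hF : LowerSemicomputable F) {g : α → β} (hg : Computable g) :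
    LowerSemicomputable fun a => F (g a) :=
  REPred.comp hF ((hg.comp Computable.fst).pair Computable.snd)

theorem rePred_lt {F : α → ℝ} (hF : LowerSemicomputable F) {u v : α → ℕ} (hu : Computable u)
    (hv : Computable v) (hpos : ∀ a, 0 < v a) : REPred fun a => (u a : ℝ) / v a < F a := by
  refine (REPred.comp hF (Computable.id.pair
    (hu.pair (Primrec.pred.to_comp.comp hv)))).of_eq fun a => ?_
  have : ((v a - 1 : ℕ) : ℝ) + 1 = v a := by
    have := hpos a
    exact_mod_cast Nat.succ_pred_eq_of_pos this
  simp only [id, Nat.pred_eq_sub_one, this]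

/-- A supremum over a recursively enumerable family is lower semicomputable. Thresholds `r ≥ 0`
suffice because only nonnegative rationals are enumerated. -/
theorem of_exists {F : α → ℝ} {P : α × β → Prop} (hP : REPred P) {G : α × β → ℝ}
    (hG : LowerSemicomputable G)
    (h : ∀ a (r : ℝ), 0 ≤ r → (r < F a ↔ ∃ b, P (a, b) ∧ r < G (a, b))) :
    LowerSemicomputable F := by
  have h1 : REPred fun q : (α × ℕ × ℕ) × β => P (q.1.1, q.2) ∧
      (q.1.2.1 : ℝ) / ((q.1.2.2 : ℝ) + 1) < G (q.1.1, q.2) := by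
    have hc : Computable fun q : (α × ℕ × ℕ) × β => (q.1.1, q.2) :=
      (Computable.fst.comp Computable.fst).pair Computable.snd
    exact (hP.comp hc).and (REPred.comp hG (hc.pair (Computable.snd.comp Computable.fst)))
  exact h1.exists.of_eq fun q => 
    (h q.1 ((q.2.1 : ℝ) / ((q.2.2 : ℝ) + 1)) (by positivity)).symm

theorem natCast {f : α → ℕ} (hf : Computable f) : LowerSemicomputable fun a => (f a : ℝ) := by
  have h1 : PrimrecPred fun q : ℕ × ℕ × ℕ => q.2.1 < q.1 * (q.2.2 + 1) :=
    Primrec.nat_lt.comp (Primrec.fst.comp Primrec.snd)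
      (Primrec.nat_mul.comp Primrec.fst (Primrec.succ.comp (Primrec.snd.comp Primrec.snd)))
  have h2 : LowerSemicomputable fun n : ℕ => (n : ℝ) :=
    h1.computablePred.to_re.of_eq fun q => by
      rw [div_lt_iff₀ (by positivity)]
      simp only
      norm_cast
  exact h2.comp hf

theorem div_nat {F : α → ℝ} (hF : LowerSemicomputable F) {v : α → ℕ} (hv : Computable v)
    (hpos : ∀ a, 0 < v a) : LowerSemicomputable fun a => F a / v a := by
  have h1 : Computable fun q : α × ℕ × ℕ => q.2.1 * v q.1 :=
    Primrec.nat_mul.to_comp.comp (Computable.fst.comp Computable.snd) (hv.comp Computable.fst)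
  refine (REPred.comp hF (Computable.fst.pair
    (h1.pair (Computable.snd.comp Computable.snd)))).of_eq fun q => ?_
  have : (0 : ℝ) < v q.1 := by exact_mod_cast hpos q.1
  rw [lt_div_iff₀ this, Nat.cast_mul, div_mul_eq_mul_div]

/-- Sums over lists of a nonnegative lower semicomputable function are lower semicomputable. -/
theorem list_sum {F : α → ℝ} (hF : LowerSemicomputable F) (h0 : ∀ a, 0 ≤ F a) :
    LowerSemicomputable fun L : List α => (L.map F).sum := by
  -- A certificate is a common denominator together with one numerator per entry. The alternative
  -- `b.2 = 0` is needed because no nonnegative rational lies strictly below a value 0.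
  have hP : REPred fun q : List α × ℕ × List (α × ℕ) =>
      q.1 = q.2.2.map Prod.fst ∧
        ∀ b ∈ q.2.2, (b.2 = 0 ∨ (b.2 : ℝ) / ((q.2.1 : ℝ) + 1) < F b.1) := by
    refine REPred.and ?_ ?_
    · exact (PrimrecPred.computablePred (Primrec.eq.comp Primrec.fst
        (Primrec.list_map (Primrec.snd.comp Primrec.snd)
          (Primrec.fst.comp Primrec.snd).to₂))).to_re
    · have h1 : REPred fun q : (List α × ℕ × List (α × ℕ)) × (α × ℕ) =>
          (q.2.2 = 0 ∨ (q.2.2 : ℝ) / ((q.1.2.1 : ℝ) + 1) < F q.2.1) := by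
        refine REPred.or ?_ ?_
        · exact (PrimrecPred.computablePred (Primrec.eq.comp (Primrec.snd.comp Primrec.snd)
            (Primrec.const 0))).to_re
        · exact REPred.comp hF ((Computable.fst.comp Computable.snd).pair
            ((Computable.snd.comp Computable.snd).pair
              (Computable.fst.comp (Computable.snd.comp Computable.fst))))
      exact h1.forall_mem (Computable.snd.comp Computable.snd)
  have hc : Computable fun q : List α × ℕ × List (α × ℕ) => (q.2.2.map Prod.snd).sum :=
    (primrec_list_sum.comp (Primrec.list_map (Primrec.snd.comp Primrec.snd)
      (Primrec.snd.comp Primrec.snd).to₂)).to_comp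
  have hd : Computable fun q : List α × ℕ × List (α × ℕ) => q.2.1 + 1 :=
    Computable.succ.comp (Computable.fst.comp Computable.snd)
  refine of_exists hP ((natCast hc).div_nat hd fun _ => Nat.succ_pos _) ?_
  intro L r hr
  constructor
  · intro h
    -- Rounding costs at most `1 / (M + 1)` per entry; `M` makes the total less than the slack.
    obtain ⟨M, hM⟩ : ∃ M : ℕ, (L.length : ℝ) / (M + 1) < (L.map F).sum - r := by
      obtain ⟨M, hM⟩ := exists_nat_gt ((L.length : ℝ) / ((L.map F).sum - r))
      refine ⟨M, ?_⟩
      have h1 : 0 < (L.map F).sum - r := by linarith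
      rw [div_lt_iff₀ h1] at hM
      rw [div_lt_iff₀ (by positivity)]
      nlinarith
    refine ⟨(M, L.map fun a => (a, ⌈F a * (M + 1)⌉₊ - 1)), ⟨?_, ?_⟩, ?_⟩
    · simp [Function.comp_def]
    · intro b hb
      obtain ⟨a, -, rfl⟩ := List.mem_map.1 hb
      rcases Nat.eq_zero_or_pos (⌈F a * (M + 1)⌉₊ - 1) with h2 | h2
      · exact Or.inl h2
      · right
        simp only
        rw [div_lt_iff₀ (by positivity)]
        exact Nat.lt_ceil.1 (by omega)
    · have key : ∀ L : List α, (L.map F).sum - L.length / ((M : ℝ) + 1) ≤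
          (((L.map fun a => (a, ⌈F a * (M + 1)⌉₊ - 1)).map Prod.snd).sum : ℕ) / ((M : ℝ) + 1) := by
        intro L
        induction L with
        | nil => simp
        | cons a L ih =>
          simp only [List.map_cons, List.sum_cons, List.length_cons, Nat.cast_add, Nat.cast_one,
            add_div]
          have h3 : F a - 1 / ((M : ℝ) + 1) ≤ ((⌈F a * (M + 1)⌉₊ - 1 : ℕ) : ℝ) / ((M : ℝ) + 1) := by
            rw [le_div_iff₀ (by positivity), sub_mul, one_div, inv_mul_cancel₀ (by positivity)]
            have h4 := Nat.le_ceil (F a * ((M : ℝ) + 1))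
            have h5 : (⌈F a * (M + 1)⌉₊ : ℝ) ≤ ((⌈F a * (M + 1)⌉₊ - 1 : ℕ) : ℝ) + 1 := by
              exact_mod_cast Nat.sub_le_iff_le_add.1 le_rfl
            linarith
          linarith
      have := key L
      push_cast at this ⊢
      linarith
  · rintro ⟨⟨M, T⟩, ⟨hL, hT⟩, h⟩
    refine h.trans_le ?_
    simp only at hL hT ⊢
    subst hL
    clear h
    induction T with
    | nil => simp
    | cons b T ih =>
      simp only [List.map_cons, List.sum_cons, Nat.cast_add, add_div]
      have h1 := ih fun c hc => hT c (List.mem_cons_of_mem _ hc)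
      have h2 : (b.2 : ℝ) / ((M + 1 : ℕ) : ℝ) ≤ F b.1 := by
        rcases hT b List.mem_cons_self with h2 | h2
        · simp [h2, h0]
        · exact_mod_cast h2.le
      push_cast at h1 h2 ⊢
      linarith

end LowerSemicomputable

/-! ### Measures of effectively open sets -/

section Union

variable {X : Type*} [MeasurableSpace X]

/-- If finite unions of basic sets have lower semicomputable measure, then so do uniformly
effectively open sets. -/
theorem LowerSemicomputable.measure_union {B : β → Set X} {μ : Measure X} [IsFiniteMeasure μ]
    (hμ : LowerSemicomputable fun L : List β => μ.real {t | ∃ c ∈ L, t ∈ B c})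
    {W : α × β → Prop} (hW : REPred W) :
    LowerSemicomputable fun a => μ.real {t | ∃ c, W (a, c) ∧ t ∈ B c} := by
  have hP : REPred fun q : α × List β => ∀ c ∈ q.2, W (q.1, c) :=
    (hW.comp ((Computable.fst.comp Computable.fst).pair Computable.snd) :
      REPred fun q : (α × List β) × β => W (q.1.1, q.2)).forall_mem Computable.snd
  refine LowerSemicomputable.of_exists hP (hμ.comp Computable.snd) fun a r hr => ?_
  -- The union is directed over finite sublists of `W`, so continuity from below finds a finite part
  -- that already exceeds `r`.
  let S : {L : List β // ∀ c ∈ L, W (a, c)} → Set X := fun L => {t | ∃ c ∈ L.1, t ∈ B c}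
  have hS : {t | ∃ c, W (a, c) ∧ t ∈ B c} = ⋃ L, S L := by
    ext t
    simp only [Set.mem_ofPred_eq, Set.mem_iUnion, S]
    constructor
    · rintro ⟨c, hc, ht⟩
      exact ⟨⟨[c], by simpa using hc⟩, c, by simp, ht⟩
    · rintro ⟨L, c, hc, ht⟩
      exact ⟨c, L.2 c hc, ht⟩
  have hdir : Directed (· ⊆ ·) S := by
    intro L L'
    refine ⟨⟨L.1 ++ L'.1, fun c hc => (List.mem_append.1 hc).elim (L.2 c) (L'.2 c)⟩, ?_, ?_⟩
    · rintro t ⟨c, hc, ht⟩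
      exact ⟨c, List.mem_append_left _ hc, ht⟩
    · rintro t ⟨c, hc, ht⟩
      exact ⟨c, List.mem_append_right _ hc, ht⟩
  constructor
  · intro h
    rw [hS, measureReal_def, ← ENNReal.ofReal_lt_iff_lt_toReal hr (measure_ne_top _ _),
      hdir.measure_iUnion, lt_iSup_iff] at h
    obtain ⟨L, hL⟩ := h
    exact ⟨L.1, L.2, (ENNReal.ofReal_lt_iff_lt_toReal hr (measure_ne_top _ _)).1 hL⟩
  · rintro ⟨L, hL, h⟩
    refine h.trans_le (measureReal_mono ?_)
    rintro t ⟨c, hc, ht⟩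
    exact ⟨c, hL c hc, ht⟩

end Union

/-! ### Open sets and measures on Cantor space -/

section Cantor

theorem mem_basicClopen_iff {x : ℕ → Bool} {σ : List Bool} :
    x ∈ basicClopen σ ↔ (List.range σ.length).map x = σ := by
  constructor
  · intro h
    refine List.ext_getElem (by simp) fun i h1 h2 => ?_
    simpa using h i h2
  · intro h i hi
    conv_rhs => rw [List.getElem_of_eq h.symm hi]
    simp

theorem measurableSet_basicClopen (σ : List Bool) : MeasurableSet (basicClopen σ) := by
  have : basicClopen σ = ⋂ (i : ℕ) (h : i < σ.length), (fun x : ℕ → Bool => x i) ⁻¹' {σ[i]} := by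
    ext x; simp [basicClopen]
  rw [this]
  exact MeasurableSet.iInter fun i => MeasurableSet.iInter fun h =>
    measurable_pi_apply i (measurableSet_singleton _)

/-- A list of distinct strings of one length, each of which extends a string in `W`. -/
def IsExtensionList (W : List Bool → Prop) (T : List (List Bool)) : Prop :=
  T.Nodup ∧ ∃ N, ∀ τ ∈ T, τ.length = N ∧ ∃ σ, W σ ∧ σ <+: τ

theorem rePred_isExtensionList {W : α × List Bool → Prop} (hW : REPred W) :
    REPred fun q : α × List (List Bool) => IsExtensionList (fun σ => W (q.1, σ)) q.2 := by
  refine REPred.and ((primrecPred_nodup.comp Primrec.snd).computablePred.to_re) ?_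
  have h1 : REPred fun q : (((α × List (List Bool)) × ℕ) × List Bool) × List Bool =>
      W (q.1.1.1.1, q.2) ∧ q.2 <+: q.1.2 :=
    (hW.comp ((Computable.fst.comp (Computable.fst.comp (Computable.fst.comp
      Computable.fst))).pair Computable.snd)).and
      (primrecRel_isPrefix.comp Primrec.snd
        (Primrec.snd.comp Primrec.fst)).computablePred.to_re
  have h2 : REPred fun q : ((α × List (List Bool)) × ℕ) × List Bool =>
      q.2.length = q.1.2 ∧ ∃ σ, W (q.1.1.1, σ) ∧ σ <+: q.2 :=
    (Primrec.eq.comp (Primrec.list_length.comp Primrec.snd)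
      (Primrec.snd.comp Primrec.fst)).computablePred.to_re.and h1.exists
  exact (h2.forall_mem (f := fun q => q.1.2) (Computable.snd.comp Computable.fst)).exists

/-- Distinct strings of equal length have disjoint cylinders. So the measures of cylinders alone
determine the measure of the union, without inclusion–exclusion. -/
theorem IsExtensionList.measure_sum {W : List Bool → Prop} {T : List (List Bool)}
    (hT : IsExtensionList W T) (μ : Measure (ℕ → Bool)) [IsFiniteMeasure μ] :
    (T.map fun τ => μ.real (basicClopen τ)).sum = μ.real {x | ∃ τ ∈ T, x ∈ basicClopen τ} := by
  obtain ⟨hnd, N, hN⟩ := hT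
  have h1 : {x | ∃ τ ∈ T, x ∈ basicClopen τ} = ⋃ τ ∈ T.toFinset, basicClopen τ := by
    ext x; simp
  rw [h1, measureReal_biUnion_finset, List.sum_toFinset _ hnd]
  · intro σ hσ τ hτ hne
    refine Set.disjoint_left.2 fun x hx hx' => hne ?_
    rw [mem_basicClopen_iff] at hx hx'
    rw [← hx, ← hx', (hN σ (by simpa using hσ)).1, (hN τ (by simpa using hτ)).1]
  · exact fun τ _ => measurableSet_basicClopen τ

/-- The cylinders of strings in `W` of length at most `N` increase to the whole union, and each such
stage is a disjoint union of cylinders of length exactly `N`. -/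
theorem lt_measureReal_cylinder_union_iff {W : List Bool → Prop} (μ : Measure (ℕ → Bool))
    [IsFiniteMeasure μ] {r : ℝ} (hr : 0 ≤ r) :
    r < μ.real {x | ∃ σ, W σ ∧ x ∈ basicClopen σ} ↔
      ∃ T, IsExtensionList W T ∧ r < (T.map fun τ => μ.real (basicClopen τ)).sum := by
  classical
  constructor
  · intro h
    let S : ℕ → Set (ℕ → Bool) := fun N =>
      {x | ∃ σ, W σ ∧ σ.length ≤ N ∧ x ∈ basicClopen σ}
    have hS : {x | ∃ σ, W σ ∧ x ∈ basicClopen σ} = ⋃ N, S N := by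
      ext x
      simp only [Set.mem_ofPred_eq, Set.mem_iUnion, S]
      exact ⟨fun ⟨σ, h1, h2⟩ => ⟨_, σ, h1, le_rfl, h2⟩, fun ⟨_, σ, h1, _, h2⟩ => ⟨σ, h1, h2⟩⟩
    have hmono : Monotone S := fun N M hNM x ⟨σ, h1, h2, h3⟩ => ⟨σ, h1, h2.trans hNM, h3⟩
    rw [hS, measureReal_def, ← ENNReal.ofReal_lt_iff_lt_toReal hr (measure_ne_top _ _),
      hmono.directed_le.measure_iUnion, lt_iSup_iff] at h
    obtain ⟨N, hN⟩ := h
    let T : Finset (List Bool) := (Finset.univ.image fun v : Fin N → Bool => List.ofFn v).filter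
      fun τ => ∃ σ, W σ ∧ σ <+: τ
    have hT : IsExtensionList W T.toList := by
      refine ⟨T.nodup_toList, N, fun τ hτ => ?_⟩
      simp only [T, Finset.mem_toList, Finset.mem_filter, Finset.mem_image, Finset.mem_univ,
        true_and] at hτ
      obtain ⟨⟨v, rfl⟩, h⟩ := hτ
      exact ⟨by simp, h⟩
    refine ⟨T.toList, hT, ?_⟩
    rw [hT.measure_sum]
    refine ((ENNReal.ofReal_lt_iff_lt_toReal hr (measure_ne_top _ _)).1 hN).trans_le
      (measureReal_mono ?_)
    rintro x ⟨σ, h1, h2, h3⟩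
    refine ⟨List.ofFn fun i : Fin N => x i, ?_, fun i hi => by simp⟩
    simp only [T, Finset.mem_toList, Finset.mem_filter, Finset.mem_image, Finset.mem_univ,
      true_and, exists_apply_eq_apply]
    refine ⟨σ, h1, ?_⟩
    rw [List.prefix_iff_getElem]
    refine ⟨by simpa using h2, fun i hi => ?_⟩
    rw [List.getElem_ofFn]
    exact (h3 i hi).symm
  · rintro ⟨T, hT, h⟩
    rw [hT.measure_sum] at h
    refine h.trans_le (measureReal_mono ?_)
    rintro x ⟨τ, hτ, hx⟩
    obtain ⟨-, σ, hσ, hpre⟩ := hT.2.choose_spec τ hτ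
    refine ⟨σ, hσ, fun i hi => ?_⟩
    rw [hx i (hi.trans_le hpre.length_le), hpre.getElem]

/-- If cylinders have lower semicomputable measure, then so do uniformly effectively open
subsets of Cantor space. -/
theorem LowerSemicomputable.measure_cylinder_union {μ : Measure (ℕ → Bool)} [IsFiniteMeasure μ]
    (hμ : LowerSemicomputable fun σ => μ.real (basicClopen σ)) {W : α × List Bool → Prop}
    (hW : REPred W) :
    LowerSemicomputable fun a => μ.real {x | ∃ σ, W (a, σ) ∧ x ∈ basicClopen σ} :=
  LowerSemicomputable.of_exists (rePred_isExtensionList hW)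
    ((hμ.list_sum fun _ => measureReal_nonneg).comp Computable.snd)
    fun _ _ hr => lt_measureReal_cylinder_union_iff μ hr

theorem IsComputableMeasure.lowerSemicomputable {μ : Measure (ℕ → Bool)}
    (hμ : IsComputableMeasure μ) : LowerSemicomputable fun σ => μ.real (basicClopen σ) := by
  obtain ⟨f, hf, h⟩ := hμ
  have hu : Computable fun q : List Bool × ℕ => f q.1 q.2 - 1 :=
    Primrec.nat_sub.to_comp.comp hf (Computable.const 1)
  have hv : Computable fun q : List Bool × ℕ => 2 ^ q.2 :=
    primrec_nat_pow.to_comp.comp (Computable.const 2) Computable.snd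
  refine LowerSemicomputable.of_exists (P := fun _ => True)
    (PrimrecPred.computablePred (PrimrecPred.of_eq
      (Primrec.eq.comp (Primrec.const 0) (Primrec.const 0)) (by simp))).to_re
    ((LowerSemicomputable.natCast hu).div_nat hv fun _ => by positivity) ?_
  intro σ r hr
  simp only [true_and]
  constructor
  · intro hlt
    -- Half the gap, because `1 / 2^n` is lost twice: in the precision of `f`, and in subtracting 1
    -- to obtain a lower bound.
    obtain ⟨n, hn⟩ := exists_pow_lt_of_lt_one (half_pos (sub_pos.2 hlt))
      (by norm_num : (1 / 2 : ℝ) < 1)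
    refine ⟨n, ?_⟩
    have h1 := (abs_le.1 (h σ n)).2
    have h2 : (f σ n : ℝ) ≤ ((f σ n - 1 : ℕ) : ℝ) + 1 := by
      exact_mod_cast Nat.sub_le_iff_le_add.1 le_rfl
    have h3 : (f σ n : ℝ) / 2 ^ n ≤ ((f σ n - 1 : ℕ) : ℝ) / 2 ^ n + 1 / 2 ^ n := by
      rw [← add_div]; gcongr
    rw [one_div_pow] at hn
    push_cast
    linarith
  · rintro ⟨n, hn⟩
    have h1 := (abs_le.1 (h σ n)).1
    -- When `f σ n = 0` the truncated approximation is 0, which exceeds no `r ≥ 0`.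
    rcases Nat.eq_zero_or_pos (f σ n) with h2 | h2
    · simp [h2] at hn; linarith
    · push_cast [Nat.cast_sub h2] at hn
      rw [sub_div] at hn
      linarith

end Cantor

/-! ### Martin-Löf tests -/

section Tests

variable {X C : Type*} [MeasurableSpace X] [Primcodable C] {B : C → Set X}

theorem MLR_subset_MLR_empty (O : Set (ℕ →. ℕ)) (μ : Measure X) : MLR B O μ ⊆ MLR B ∅ μ :=
  fun _ ht U ⟨⟨W, hW, hU⟩, hμ⟩ => ht U ⟨⟨W, RecursiveIn.mono (Set.empty_subset _) hW, hU⟩, hμ⟩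

/-- A random point lies in only finitely many members of a uniformly effectively open sequence
whose measures decrease geometrically. -/
theorem eventually_notMem_of_mem_MLR {μ : Measure X} {t : X} (ht : t ∈ MLR B ∅ μ)
    {W : ℕ × C → Prop} (hW : REPred W)
    (hμ : ∀ i, μ {t | ∃ c, W (i, c) ∧ t ∈ B c} ≤ (2⁻¹ : ENNReal) ^ i) :
    ∃ N, ∀ i, N < i → ∀ c, W (i, c) → t ∉ B c := by
  by_contra! hcon
  -- Starting the tail at `N + 1` makes the geometric sum exactly `2^(-N)`.
  let V : ℕ → Set X := fun N => {t | ∃ c, (∃ i, N < i ∧ W (i, c)) ∧ t ∈ B c}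
  have hV : ∀ N, V N = ⋃ j, {t | ∃ c, W (N + j + 1, c) ∧ t ∈ B c} := by
    intro N
    ext t
    simp only [V, Set.mem_ofPred_eq, Set.mem_iUnion]
    constructor
    · rintro ⟨c, ⟨i, hi, hW⟩, ht⟩
      exact ⟨i - N - 1, c, by rwa [show N + (i - N - 1) + 1 = i by omega], ht⟩
    · rintro ⟨j, c, hW, ht⟩
      exact ⟨c, ⟨_, by omega, hW⟩, ht⟩
  refine ht V ⟨⟨fun q => ∃ i, q.1 < i ∧ W (i, q.2), (rePredIn_empty_iff _).2 ?_, fun i => rfl⟩, ?_⟩ ?_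
  · have : REPred fun q : (ℕ × C) × ℕ => q.1.1 < q.2 ∧ W (q.2, q.1.2) :=
      (Primrec.nat_lt.comp (Primrec.fst.comp Primrec.fst) Primrec.snd).computablePred.to_re.and
        (hW.comp (Computable.snd.pair (Computable.snd.comp Computable.fst)))
    exact this.exists
  · intro N
    rw [hV]
    refine (measure_iUnion_le _).trans ?_
    calc ∑' j, μ {t | ∃ c, W (N + j + 1, c) ∧ t ∈ B c}
        ≤ ∑' j, (2⁻¹ : ENNReal) ^ N * (2⁻¹ : ENNReal) ^ (j + 1) := by
          refine ENNReal.tsum_le_tsum fun j => (hμ _).trans_eq ?_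
          rw [← pow_add, add_assoc]
      _ = (2⁻¹ : ENNReal) ^ N := by
          rw [ENNReal.tsum_mul_left, ENNReal.tsum_geometric_add_one, ENNReal.one_sub_inv_two,
            inv_inv, ENNReal.inv_mul_cancel (by simp) (by simp), mul_one]
  · rw [Set.mem_iInter]
    intro N
    obtain ⟨i, hi, c, hW, ht⟩ := hcon N
    exact ⟨c, ⟨i, hi, hW⟩, ht⟩

end Tests

/-- The complement of a cylinder is the union of the other cylinders of the same length, so its
measure is lower semicomputable too. As the total mass is 1, this yields approximations from above.
-/
theorem isComputableMeasure_of_lowerSemicomputable {μ : Measure (ℕ → Bool)}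
    [IsProbabilityMeasure μ] (hμ : LowerSemicomputable fun σ => μ.real (basicClopen σ)) :
    IsComputableMeasure μ := by
  have hcompl : LowerSemicomputable fun σ => μ.real (basicClopen σ)ᶜ := by
    have h1 : REPred fun q : List Bool × List Bool => q.2.length = q.1.length ∧ ¬ q.2 = q.1 :=
      ((Primrec.eq.comp (Primrec.list_length.comp Primrec.snd)
        (Primrec.list_length.comp Primrec.fst)).and
        (Primrec.eq.comp Primrec.snd Primrec.fst).not).computablePred.to_re
    have h2 := hμ.measure_cylinder_union h1
    convert h2 using 3 with σ
    ext x
    simp only [Set.mem_compl_iff, mem_basicClopen_iff, Set.mem_ofPred_eq]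
    constructor
    · exact fun h => ⟨_, ⟨by simp, h⟩, by simp⟩
    · rintro ⟨τ, ⟨h3, h4⟩, h5⟩
      rwa [← h3, h5]
  have hpow : Computable fun n : ℕ => 2 ^ (n + 1) :=
    primrec_nat_pow.to_comp.comp (Computable.const 2) Computable.succ
  have happ : ∀ {F : List Bool → ℝ}, LowerSemicomputable F →
      REPred fun q : (List Bool × ℕ) × ℕ => q.2 = 0 ∨
        (q.2 : ℝ) / (2 ^ (q.1.2 + 1) : ℕ) < F q.1.1 := fun hF =>
    (Primrec.eq.comp Primrec.snd (Primrec.const 0)).computablePred.to_re.or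
      ((hF.comp (Computable.fst.comp Computable.fst)).rePred_lt Computable.snd
        (hpow.comp (Computable.snd.comp Computable.fst)) fun _ => by positivity)
  -- With lower bounds `k` and `l`, in units of `2^(-(n+1))`, for a cylinder and its complement,
  -- this condition confines the measure of the cylinder to between `k` and `k + 2` units.
  have hsum : REPred fun q : (List Bool × ℕ) × (ℕ × ℕ) =>
      2 ^ (q.1.2 + 1) ≤ q.2.1 + q.2.2 + 2 := by
    refine PrimrecPred.computablePred (Primrec.nat_le.comp ?_ ?_) |>.to_re
    · exact primrec_nat_pow.comp (Primrec.const 2)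
        (Primrec.succ.comp (Primrec.snd.comp Primrec.fst))
    · exact Primrec.nat_add.comp (Primrec.nat_add.comp (Primrec.fst.comp Primrec.snd)
        (Primrec.snd.comp Primrec.snd)) (Primrec.const 2)
  have hfst : Computable fun q : (List Bool × ℕ) × (ℕ × ℕ) => (q.1, q.2.1) :=
    Computable.fst.pair (Computable.fst.comp Computable.snd)
  have hsnd : Computable fun q : (List Bool × ℕ) × (ℕ × ℕ) => (q.1, q.2.2) :=
    Computable.fst.pair (Computable.snd.comp Computable.snd)
  have hcompl_eq : ∀ σ, μ.real (basicClopen σ)ᶜ = 1 - μ.real (basicClopen σ) := fun σ => by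
    rw [probReal_compl_eq_one_sub (measurableSet_basicClopen σ)]
  obtain ⟨f, hf, hfP⟩ := (((happ hμ).comp hfst).and
    (((happ hcompl).comp hsnd).and hsum)).exists_computable_choice (by
      rintro ⟨σ, n⟩
      have hex : ∀ t : ℝ, 0 ≤ t → ∃ k : ℕ, (k = 0 ∨ (k : ℝ) / (2 ^ (n + 1) : ℕ) < t) ∧
          t * (2 ^ (n + 1) : ℕ) ≤ k + 1 := by
        intro t ht
        refine ⟨⌈t * (2 ^ (n + 1) : ℕ)⌉₊ - 1, ?_, ?_⟩
        · rcases Nat.eq_zero_or_pos (⌈t * (2 ^ (n + 1) : ℕ)⌉₊ - 1) with h2 | h2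
          · exact Or.inl h2
          · right
            rw [div_lt_iff₀ (by positivity)]
            exact Nat.lt_ceil.1 (by omega)
        · refine (Nat.le_ceil _).trans ?_
          exact_mod_cast Nat.sub_le_iff_le_add.1 le_rfl
      obtain ⟨k, hk, hk'⟩ := hex (μ.real (basicClopen σ)) measureReal_nonneg
      obtain ⟨l, hl, hl'⟩ := hex (μ.real (basicClopen σ)ᶜ) measureReal_nonneg
      refine ⟨(k, l), hk, hl, ?_⟩
      rw [hcompl_eq] at hl'
      have : ((2 ^ (n + 1) : ℕ) : ℝ) ≤ ((k + l + 2 : ℕ) : ℝ) := by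
        push_cast at hk' hl' ⊢
        linarith
      exact_mod_cast this)
  -- The midpoint `k + 1` of that interval, rounded to denominator `2^n`: half a unit of `2^(-n)`
  -- for the interval and at most half for the rounding.
  refine ⟨fun σ n => ((f (σ, n)).1 + 1) / 2, ?_, fun σ n => ?_⟩
  · exact Primrec.nat_div.to_comp.comp (Computable.succ.comp (Computable.fst.comp hf))
      (Computable.const 2)
  · obtain ⟨h1, h2, h3⟩ := hfP (σ, n)
    dsimp only at h1 h2 h3 ⊢
    generalize f (σ, n) = kl at *
    obtain ⟨k, l⟩ := kl
    simp only at h1 h2 h3 ⊢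
    set D : ℝ := ((2 ^ (n + 1) : ℕ) : ℝ) with hD
    have hDpos : 0 < D := by positivity
    have hD2 : D = 2 * 2 ^ n := by rw [hD]; push_cast; ring
    have hk : (k : ℝ) ≤ μ.real (basicClopen σ) * D := by
      rcases h1 with rfl | h1
      · simpa using mul_nonneg measureReal_nonneg hDpos.le
      · exact ((div_lt_iff₀ hDpos).1 h1).le
    have hl : (l : ℝ) ≤ (1 - μ.real (basicClopen σ)) * D := by
      rw [← hcompl_eq]
      rcases h2 with rfl | h2
      · simpa using mul_nonneg measureReal_nonneg hDpos.le
      · exact ((div_lt_iff₀ hDpos).1 h2).le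
    have hkl : D ≤ k + l + 2 := by rw [hD]; exact_mod_cast h3
    have hr1 : (k : ℝ) ≤ 2 * (((k + 1) / 2 : ℕ) : ℝ) := by
      exact_mod_cast (by omega : k ≤ 2 * ((k + 1) / 2))
    have hr2 : 2 * (((k + 1) / 2 : ℕ) : ℝ) ≤ k + 1 := by
      exact_mod_cast (by omega : 2 * ((k + 1) / 2) ≤ k + 1)
    have h2n : (0 : ℝ) < 2 ^ n := by positivity
    rw [hD2] at hk hl hkl
    rw [abs_le, neg_le_sub_iff_le_add, sub_le_iff_le_add, ← add_div, div_le_iff₀ h2n,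
      le_div_iff₀' h2n, add_mul, div_mul_cancel₀ _ h2n.ne']
    constructor <;> linarith

/-! ### Bernoulli measures as a function of the parameter -/

section Bernoulli

instance (p : unitInterval) : IsProbabilityMeasure (bernoulliMu p) := by
  unfold bernoulliMu; infer_instance

theorem bernoulliMu_real_basicClopen (p : unitInterval) (σ : List Bool) :
    (bernoulliMu p).real (basicClopen σ) =
      (p : ℝ) ^ σ.count false * (1 - (p : ℝ)) ^ σ.count true := by
  let g : Bool → ℝ := fun b => (ProbabilityTheory.bernoulliMeasure false true p).real {b}
  have hgf : g false = p := by simp [g]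
  have hgt : g true = 1 - p := by simp [g]
  have h1 : basicClopen σ = Set.pi (Finset.range σ.length) fun i => {σ.getD i false} := by
    ext x
    simp only [basicClopen, Set.mem_ofPred_eq, Set.mem_pi, Finset.coe_range, Set.mem_Iio,
      Set.mem_singleton_iff]
    refine forall_congr' fun i => forall_congr' fun h => ?_
    rw [List.getD_eq_getElem _ _ h]
  have h2 : (bernoulliMu p).real (basicClopen σ) = ∏ i ∈ Finset.range σ.length,
      g (σ.getD i false) := by
    rw [h1, measureReal_def, bernoulliMu, Measure.infinitePi_pi _ fun _ _ => measurableSet_singleton _,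
      ENNReal.toReal_prod]
    rfl
  rw [h2, ← hgt, ← hgf]
  clear h1 h2
  induction σ with
  | nil => simp
  | cons b σ ih =>
    rw [List.length_cons, Finset.prod_range_succ']
    simp only [List.getD_cons_succ, List.getD_cons_zero, ih]
    cases b <;> simp <;> ring

theorem measurable_bernoulliMu : Measurable bernoulliMu := by
  refine .measure_of_isPiSystem_of_isProbabilityMeasure
    (S := squareCylinders fun _ : ℕ => {s : Set Bool | MeasurableSet s})
    generateFrom_squareCylinders.symm
    (isPiSystem_squareCylinders (fun _ => MeasurableSpace.isPiSystem_measurableSet) (by simp)) ?_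
  rintro _ ⟨s, t, ht, rfl⟩
  have h1 : ∀ p, bernoulliMu p (Set.pi s t) =
      ∏ i ∈ s, ProbabilityTheory.bernoulliMeasure false true p (t i) := fun p => by
    rw [bernoulliMu, Measure.infinitePi_pi]
    exact fun i _ => ht i (Set.mem_univ i)
  simp only [h1]
  refine Finset.measurable_prod _ fun i _ => ?_
  simp only [ProbabilityTheory.bernoulliMeasure_def, Measure.add_apply,
    unitInterval.toNNReal]
  have h2 : Measurable fun p : unitInterval => (p : ℝ) := measurable_subtype_coe
  have h3 : Measurable fun p : unitInterval => ((unitInterval.symm p : unitInterval) : ℝ) := by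
    simpa using h2.const_sub 1
  exact ((h2.subtype_mk.coe_nnreal_ennreal).mul_const _).add
    ((h3.subtype_mk.coe_nnreal_ennreal).mul_const _)

/-- A lower bound for the Bernoulli measure of `⟦σ⟧` that holds for all parameters in the ball
coded by `c`. -/
noncomputable def ballWeight (c : ℕ × ℕ × ℕ) (σ : List Bool) : ℝ :=
  (((c.1 - c.2.1 : ℕ) : ℝ) / (c.2.2 + 1)) ^ σ.count false *
    (((c.2.2 + 1 - c.1 - c.2.1 : ℕ) : ℝ) / (c.2.2 + 1)) ^ σ.count true

theorem ballWeight_nonneg (c : ℕ × ℕ × ℕ) (σ : List Bool) : 0 ≤ ballWeight c σ := by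
  unfold ballWeight; positivity

theorem ballWeight_le {c : ℕ × ℕ × ℕ} {q : unitInterval} (hq : q ∈ ratBall c) (σ : List Bool) :
    ballWeight c σ ≤ (bernoulliMu q).real (basicClopen σ) := by
  obtain ⟨A, R, d⟩ := c
  rw [bernoulliMu_real_basicClopen]
  have hd : (0 : ℝ) < d + 1 := by positivity
  simp only [ratBall, Set.mem_ofPred_eq, abs_lt] at hq
  obtain ⟨h1, h2⟩ := hq
  have hq0 := q.2.1
  have hq1 := q.2.2
  have e1 : (A : ℝ) / (d + 1) * (d + 1) = A := div_mul_cancel₀ _ hd.ne'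
  have e2 : (R : ℝ) / (d + 1) * (d + 1) = R := div_mul_cancel₀ _ hd.ne'
  have h3 : (q : ℝ) * (d + 1) < A + R := by
    have := mul_lt_mul_of_pos_right h2 hd
    rw [sub_mul, e1, e2] at this; linarith
  have h4 : (A : ℝ) - R < q * (d + 1) := by
    have := mul_lt_mul_of_pos_right h1 hd
    rw [sub_mul, neg_mul, e1, e2] at this; linarith
  have h5 : ((A - R : ℕ) : ℝ) / (d + 1) ≤ q := by
    rw [div_le_iff₀ hd]
    rcases le_total A R with h | h
    · rw [Nat.sub_eq_zero_of_le h]; simpa using mul_nonneg hq0 hd.le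
    · rw [Nat.cast_sub h]; exact h4.le
  have h6 : ((d + 1 - A - R : ℕ) : ℝ) / (d + 1) ≤ 1 - q := by
    rw [div_le_iff₀ hd, Nat.sub_sub]
    rcases le_total (d + 1) (A + R) with h | h
    · rw [Nat.sub_eq_zero_of_le h]; simpa using mul_nonneg (sub_nonneg.2 hq1) hd.le
    · rw [Nat.cast_sub h]; push_cast; linarith
  unfold ballWeight
  exact mul_le_mul (pow_le_pow_left₀ (by positivity) h5 _) (pow_le_pow_left₀ (by positivity) h6 _)
    (by positivity) (by positivity)

theorem mem_ratBall_floor (q : unitInterval) (n : ℕ) :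
    q ∈ ratBall (⌊(q : ℝ) * (n + 1)⌋₊, 2, n) := by
  have hn : (0 : ℝ) < n + 1 := by positivity
  have h1 := Nat.floor_le (mul_nonneg q.2.1 hn.le)
  have h2 := Nat.lt_floor_add_one ((q : ℝ) * (n + 1))
  simp only [ratBall, Set.mem_ofPred_eq]
  rw [abs_lt, neg_lt_sub_iff_lt_add, sub_lt_iff_lt_add, ← add_div, div_lt_iff₀ hn,
    lt_div_iff₀ hn, add_mul, div_mul_cancel₀ _ hn.ne']
  push_cast
  constructor <;> linarith

theorem tendsto_ballWeight (q : unitInterval) (σ : List Bool) :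
    Tendsto (fun n : ℕ => ballWeight (⌊(q : ℝ) * (n + 1)⌋₊, 2, n) σ) atTop
      (𝓝 ((bernoulliMu q).real (basicClopen σ))) := by
  have h0 : Tendsto (fun n : ℕ => 3 * (1 / ((n : ℝ) + 1))) atTop (𝓝 (3 * 0)) :=
    tendsto_one_div_add_atTop_nhds_zero_nat.const_mul 3
  -- The numerators fall short by at most 3: at most one from the floor and two from the radius.
  have hsq : ∀ {f : ℕ → ℝ} {a : ℝ}, (∀ n : ℕ, a * (n + 1) - 3 ≤ f n) →
      (∀ n : ℕ, f n ≤ a * (n + 1)) →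
      Tendsto (fun n : ℕ => f n / ((n : ℝ) + 1)) atTop (𝓝 a) := by
    intro f a hl hu
    refine tendsto_of_tendsto_of_tendsto_of_le_of_le (g := fun n : ℕ => a - 3 * (1 / ((n : ℝ) + 1)))
      (h := fun _ => a) ?_ tendsto_const_nhds ?_ ?_
    · simpa using h0.const_sub a
    · intro n
      have hn : (0 : ℝ) < n + 1 := by positivity
      show a - 3 * (1 / ((n : ℝ) + 1)) ≤ f n / ((n : ℝ) + 1)
      rw [le_div_iff₀ hn, sub_mul, mul_assoc, one_div, inv_mul_cancel₀ hn.ne']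
      linarith [hl n]
    · intro n
      have hn : (0 : ℝ) < n + 1 := by positivity
      show f n / ((n : ℝ) + 1) ≤ a
      rw [div_le_iff₀ hn]
      exact hu n
  rw [bernoulliMu_real_basicClopen]
  unfold ballWeight
  have hq0 := q.2.1
  have hq1 := q.2.2
  have hfl : ∀ n : ℕ, (⌊(q : ℝ) * (n + 1)⌋₊ : ℝ) ≤ q * (n + 1) := fun n =>
    Nat.floor_le (mul_nonneg hq0 (by positivity))
  have hfl' : ∀ n : ℕ, (q : ℝ) * (n + 1) < ⌊(q : ℝ) * (n + 1)⌋₊ + 1 := fun n =>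
    Nat.lt_floor_add_one _
  refine Tendsto.mul (Tendsto.pow (hsq ?_ ?_) _) (Tendsto.pow (hsq ?_ ?_) _)
  · intro n
    have : ((⌊(q : ℝ) * (n + 1)⌋₊ : ℕ) : ℝ) ≤ ((⌊(q : ℝ) * (n + 1)⌋₊ - 2 : ℕ) : ℝ) + 2 := by
      exact_mod_cast Nat.sub_le_iff_le_add.1 le_rfl
    linarith [hfl' n]
  · intro n
    exact le_trans (by exact_mod_cast Nat.sub_le _ _) (hfl n)
  · intro n
    have : ((n + 1 : ℕ) : ℝ) ≤ ((n + 1 - ⌊(q : ℝ) * (n + 1)⌋₊ - 2 : ℕ) : ℝ) +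
        ⌊(q : ℝ) * (n + 1)⌋₊ + 2 := by
      exact_mod_cast (by omega : n + 1 ≤ (n + 1 - ⌊(q : ℝ) * (n + 1)⌋₊ - 2) +
        ⌊(q : ℝ) * (n + 1)⌋₊ + 2)
    push_cast at this
    linarith [hfl n]
  · intro n
    rcases le_total (n + 1) (⌊(q : ℝ) * (n + 1)⌋₊ + 2) with h | h
    · rw [Nat.sub_sub, Nat.sub_eq_zero_of_le h]
      simpa using mul_nonneg (sub_nonneg.2 hq1) (by positivity : (0 : ℝ) ≤ n + 1)
    · rw [Nat.sub_sub, Nat.cast_sub h]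
      push_cast
      linarith [hfl' n]

/-- The weights are lower bounds valid on a whole ball, and they become exact as the balls shrink to
`q`. Hence the parameters whose measures exceed `r` form a union of balls chosen by a condition that
does not mention `q`; this makes such sets effectively open. -/
theorem lt_sum_bernoulliMu_iff (q : unitInterval) (T : List (List Bool)) (r : ℝ) :
    r < (T.map fun τ => (bernoulliMu q).real (basicClopen τ)).sum ↔
      ∃ c, r < (T.map fun τ => ballWeight c τ).sum ∧ q ∈ ratBall c := by
  constructor
  · intro h
    have h1 : Tendsto (fun n : ℕ =>
        (T.map fun τ => ballWeight (⌊(q : ℝ) * (n + 1)⌋₊, 2, n) τ).sum) atTop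
        (𝓝 (T.map fun τ => (bernoulliMu q).real (basicClopen τ)).sum) :=
      tendsto_list_sum _ fun τ _ => tendsto_ballWeight q τ
    obtain ⟨n, hn⟩ := (h1.eventually_const_lt h).exists
    exact ⟨_, hn, mem_ratBall_floor q n⟩
  · rintro ⟨c, hc, hq⟩
    exact hc.trans_le (List.sum_le_sum fun τ _ => ballWeight_le hq τ)

theorem primrec_count (b : Bool) : Primrec fun σ : List Bool => σ.count b := by
  refine (Primrec.list_length.comp (Primrec.listFilter (p := fun a => a = b)
    (Primrec.eq.comp Primrec.id (Primrec.const b)))).of_eq fun σ => ?_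
  rw [List.count_eq_length_filter]
  congr 2

theorem lowerSemicomputable_ballWeight :
    LowerSemicomputable fun q : (ℕ × ℕ × ℕ) × List Bool => ballWeight q.1 q.2 := by
  have hd : Primrec fun q : (ℕ × ℕ × ℕ) × List Bool => q.1.2.2 + 1 :=
    Primrec.succ.comp (Primrec.snd.comp (Primrec.snd.comp Primrec.fst))
  have hA : Primrec fun q : (ℕ × ℕ × ℕ) × List Bool => q.1.1 := Primrec.fst.comp Primrec.fst
  have hR : Primrec fun q : (ℕ × ℕ × ℕ) × List Bool => q.1.2.1 :=
    Primrec.fst.comp (Primrec.snd.comp Primrec.fst)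
  have hnum : Primrec fun q : (ℕ × ℕ × ℕ) × List Bool =>
      (q.1.1 - q.1.2.1) ^ q.2.count false * (q.1.2.2 + 1 - q.1.1 - q.1.2.1) ^ q.2.count true :=
    Primrec.nat_mul.comp
      (primrec_nat_pow.comp (Primrec.nat_sub.comp hA hR) ((primrec_count false).comp Primrec.snd))
      (primrec_nat_pow.comp (Primrec.nat_sub.comp (Primrec.nat_sub.comp hd hA) hR)
        ((primrec_count true).comp Primrec.snd))
  have hden : Primrec fun q : (ℕ × ℕ × ℕ) × List Bool => (q.1.2.2 + 1) ^ q.2.length :=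
    primrec_nat_pow.comp hd (Primrec.list_length.comp Primrec.snd)
  convert (LowerSemicomputable.natCast hnum.to_comp).div_nat hden.to_comp
    fun _ => by positivity using 2 with q
  rw [ballWeight, ← List.count_false_add_count_true]
  push_cast
  rw [div_pow, div_pow, div_mul_div_comm, pow_add]

end Bernoulli

theorem measurableSet_ratBall (c : ℕ × ℕ × ℕ) : MeasurableSet (ratBall c) :=
  measurableSet_lt (by fun_prop) measurable_const

theorem measurableSet_union_ratBall (P : ℕ × ℕ × ℕ → Prop) :
    MeasurableSet {t | ∃ c, P c ∧ t ∈ ratBall c} := by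
  have : {t | ∃ c, P c ∧ t ∈ ratBall c} = ⋃ (c) (_ : P c), ratBall c := by ext; simp
  rw [this]
  exact MeasurableSet.iUnion fun c => MeasurableSet.iUnion fun _ => measurableSet_ratBall c

theorem measurableSet_union_basicClopen (P : List Bool → Prop) :
    MeasurableSet {x | ∃ σ, P σ ∧ x ∈ basicClopen σ} := by
  have : {x | ∃ σ, P σ ∧ x ∈ basicClopen σ} = ⋃ (σ) (_ : P σ), basicClopen σ := by ext; simp
  rw [this]
  exact MeasurableSet.iUnion fun c => MeasurableSet.iUnion fun _ => measurableSet_basicClopen c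

/-! ### Integrals through superlevel sets -/

section LayerCake

/-- The sum counts the positive multiples of `1 / (N + 1)` strictly below `t`; there are `⌈t (N +
1)⌉ - 1` of them, or none if `t = 0`. -/
theorem sum_ite_range_div_lt {t : ℝ} (ht0 : 0 ≤ t) (ht1 : t ≤ 1) (N : ℕ) :
    ((∑ j ∈ Finset.range (N + 1), if ((j + 1 : ℕ) : ℝ) / ((N + 1 : ℕ) : ℝ) < t then (1 : ℝ) else 0) ≤
      t * (N + 1)) ∧
    t * (N + 1) - 1 ≤
      ∑ j ∈ Finset.range (N + 1), if ((j + 1 : ℕ) : ℝ) / ((N + 1 : ℕ) : ℝ) < t then (1 : ℝ) else 0 := by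
  have hpos : (0 : ℝ) < ((N + 1 : ℕ) : ℝ) := by positivity
  have hceil : ⌈t * ((N + 1 : ℕ) : ℝ)⌉₊ ≤ N + 1 := by
    rw [Nat.ceil_le]
    exact mul_le_of_le_one_left hpos.le ht1
  have hf : (Finset.range (N + 1)).filter (fun j => ((j + 1 : ℕ) : ℝ) / ((N + 1 : ℕ) : ℝ) < t) =
      Finset.range (⌈t * ((N + 1 : ℕ) : ℝ)⌉₊ - 1) := by
    ext j
    rw [Finset.mem_filter, Finset.mem_range, Finset.mem_range, div_lt_iff₀ hpos, ← Nat.lt_ceil]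
    omega
  rw [← Finset.sum_filter, hf]
  simp only [Finset.sum_const, Finset.card_range, nsmul_eq_mul, mul_one]
  have h1 := Nat.ceil_lt_add_one (mul_nonneg ht0 hpos.le)
  have h2 := Nat.le_ceil (t * ((N + 1 : ℕ) : ℝ))
  have h0 := mul_nonneg ht0 hpos.le
  push_cast at h0 h1 h2 ⊢
  constructor
  · rcases Nat.eq_zero_or_pos ⌈t * ((N : ℝ) + 1)⌉₊ with h | h
    · rw [h]; simpa using h0
    · rw [Nat.cast_sub h]; push_cast; linarith
  · have : ((⌈t * ((N : ℝ) + 1)⌉₊ : ℕ) : ℝ) ≤ ((⌈t * ((N : ℝ) + 1)⌉₊ - 1 : ℕ) : ℝ) + 1 := by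
      exact_mod_cast Nat.sub_le_iff_le_add.1 le_rfl
    linarith

/-- Integrating the pointwise count gives lower sums within `1 / (N + 1)` of the integral. They
involve only measures of superlevel sets, which for the functions `q ↦ μ_q ⟦σ⟧` are effectively
open. -/
theorem lt_integral_iff_exists_lt_sum {X : Type*} [MeasurableSpace X] (ν : Measure X)
    [IsProbabilityMeasure ν] {f : X → ℝ} (hf : Measurable f) (h0 : ∀ q, 0 ≤ f q)
    (h1 : ∀ q, f q ≤ 1) (r : ℝ) :
    r < ∫ q, f q ∂ν ↔ ∃ N : ℕ, r < (((List.range (N + 1)).map fun j =>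
      ν.real {q | ((j + 1 : ℕ) : ℝ) / ((N + 1 : ℕ) : ℝ) < f q}).sum) / ((N + 1 : ℕ) : ℝ) := by
  have hfi : Integrable f ν := Integrable.of_bound hf.aestronglyMeasurable 1
    (ae_of_all _ fun q => by rw [Real.norm_eq_abs, abs_of_nonneg (h0 q)]; exact h1 q)
  have hms : ∀ N j : ℕ, MeasurableSet {q | ((j + 1 : ℕ) : ℝ) / ((N + 1 : ℕ) : ℝ) < f q} :=
    fun N j => measurableSet_lt measurable_const hf
  have hind : ∀ N j : ℕ, (fun q => if ((j + 1 : ℕ) : ℝ) / ((N + 1 : ℕ) : ℝ) < f q then (1 : ℝ) else 0)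
      = Set.indicator {q | ((j + 1 : ℕ) : ℝ) / ((N + 1 : ℕ) : ℝ) < f q} 1 := by
    intro N j
    ext q
    simp [Set.indicator_apply]
  have hii : ∀ N j : ℕ, Integrable (fun q => if ((j + 1 : ℕ) : ℝ) / ((N + 1 : ℕ) : ℝ) < f q
      then (1 : ℝ) else 0) ν := by
    intro N j
    rw [hind]
    exact (integrable_const (1 : ℝ)).indicator (hms N j)
  have hsum : ∀ N : ℕ, ((List.range (N + 1)).map fun j =>
      ν.real {q | ((j + 1 : ℕ) : ℝ) / ((N + 1 : ℕ) : ℝ) < f q}).sum =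
      ∫ q, ∑ j ∈ Finset.range (N + 1), (if ((j + 1 : ℕ) : ℝ) / ((N + 1 : ℕ) : ℝ) < f q
        then (1 : ℝ) else 0) ∂ν := by
    intro N
    rw [integral_finsetSum _ fun j _ => hii N j, ← List.sum_toFinset _ List.nodup_range,
      List.toFinset_range]
    refine Finset.sum_congr rfl fun j _ => ?_
    rw [hind, integral_indicator_one (hms N j)]
  have hle : ∀ N : ℕ, (((List.range (N + 1)).map fun j =>
      ν.real {q | ((j + 1 : ℕ) : ℝ) / ((N + 1 : ℕ) : ℝ) < f q}).sum) ≤ (∫ q, f q ∂ν) * (N + 1) := by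
    intro N
    rw [hsum, ← integral_mul_const]
    exact integral_mono (integrable_finsetSum _ fun j _ => hii N j) (hfi.mul_const _)
      fun q => (sum_ite_range_div_lt (h0 q) (h1 q) N).1
  have hge : ∀ N : ℕ, (∫ q, f q ∂ν) * (N + 1) - 1 ≤ (((List.range (N + 1)).map fun j =>
      ν.real {q | ((j + 1 : ℕ) : ℝ) / ((N + 1 : ℕ) : ℝ) < f q}).sum) := by
    intro N
    have h2 : (∫ q, f q ∂ν) * (N + 1) - 1 = ∫ q, (f q * (N + 1) - 1) ∂ν := by
      rw [integral_sub (hfi.mul_const _) (integrable_const _), integral_mul_const]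
      simp
    rw [h2, hsum]
    exact integral_mono ((hfi.mul_const _).sub (integrable_const _))
      (integrable_finsetSum _ fun j _ => hii N j)
      fun q => (sum_ite_range_div_lt (h0 q) (h1 q) N).2
  constructor
  · intro h
    obtain ⟨N, hN⟩ := exists_nat_gt (1 / (∫ q, f q ∂ν - r))
    refine ⟨N, ?_⟩
    rw [div_lt_iff₀ (sub_pos.2 h)] at hN
    rw [lt_div_iff₀ (by positivity)]
    refine lt_of_lt_of_le ?_ (hge N)
    push_cast
    nlinarith
  · rintro ⟨N, hN⟩
    rw [lt_div_iff₀ (by positivity)] at hN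
    have := hN.trans_le (hle N)
    push_cast at this
    exact lt_of_mul_lt_mul_right this (by positivity)

end LayerCake

/-! ### Mixtures of Bernoulli measures: from `p` to `x` -/

section Mixture

variable {ν : Measure unitInterval}

/-- The mixture `∫ μ_q dν(q)` of Bernoulli measures. -/
noncomputable def bernoulliMixture (ν : Measure unitInterval) : Measure (ℕ → Bool) :=
  ν.bind bernoulliMu

theorem bernoulliMixture_apply {s : Set (ℕ → Bool)} (hs : MeasurableSet s) :
    bernoulliMixture ν s = ∫⁻ q, bernoulliMu q s ∂ν :=
  Measure.bind_apply hs measurable_bernoulliMu.aemeasurable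

instance [IsProbabilityMeasure ν] : IsProbabilityMeasure (bernoulliMixture ν) :=
  ⟨by rw [bernoulliMixture_apply MeasurableSet.univ]; simp⟩

theorem measurable_bernoulliMu_apply {s : Set (ℕ → Bool)} (hs : MeasurableSet s) :
    Measurable fun q => bernoulliMu q s :=
  (Measure.measurable_coe hs).comp measurable_bernoulliMu

theorem bernoulliMixture_real {s : Set (ℕ → Bool)} (hs : MeasurableSet s) :
    (bernoulliMixture ν).real s = ∫ q, (bernoulliMu q).real s ∂ν := by
  simp only [measureReal_def]
  rw [bernoulliMixture_apply hs, integral_toReal (measurable_bernoulliMu_apply hs).aemeasurable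
    (ae_of_all _ fun q => measure_lt_top _ _)]

theorem lowerSemicomputable_bernoulliMixture [IsProbabilityMeasure ν]
    (hν : IsComputableMeasureUnit ν) :
    LowerSemicomputable fun σ => (bernoulliMixture ν).real (basicClopen σ) := by
  have hW : REPred fun q : (List Bool × ℕ × ℕ) × (ℕ × ℕ × ℕ) =>
      ((q.1.2.2 + 1 : ℕ) : ℝ) / ((q.1.2.1 + 1 : ℕ) : ℝ) < ballWeight q.2 q.1.1 :=
    (lowerSemicomputable_ballWeight.comp (Computable.snd.pair
      (Computable.fst.comp Computable.fst))).rePred_lt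
      (Computable.succ.comp (Computable.snd.comp (Computable.snd.comp Computable.fst)))
      (Computable.succ.comp (Computable.fst.comp (Computable.snd.comp Computable.fst)))
      fun _ => Nat.succ_pos _
  have h1 : LowerSemicomputable fun q : List Bool × ℕ × ℕ =>
      ν.real {t | ((q.2.2 + 1 : ℕ) : ℝ) / ((q.2.1 + 1 : ℕ) : ℝ) <
        (bernoulliMu t).real (basicClopen q.1)} := by
    have h2 := LowerSemicomputable.measure_union (B := ratBall) (μ := ν) hν hW
    convert h2 using 3 with q
    ext t
    have h3 := lt_sum_bernoulliMu_iff t [q.1] (((q.2.2 + 1 : ℕ) : ℝ) / ((q.2.1 + 1 : ℕ) : ℝ))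
    simpa using h3
  have hlist : Computable fun q : List Bool × ℕ =>
      (List.range (q.2 + 1)).map fun j => (q.1, q.2, j) :=
    (Primrec.list_map (Primrec.list_range.comp (Primrec.succ.comp Primrec.snd))
      ((Primrec.fst.comp Primrec.fst).pair
        ((Primrec.snd.comp Primrec.fst).pair Primrec.snd)).to₂).to_comp
  have h2 := ((h1.list_sum fun _ => measureReal_nonneg).comp hlist).div_nat
    (v := fun q : List Bool × ℕ => q.2 + 1) (Computable.succ.comp Computable.snd)
    fun _ => Nat.succ_pos _
  refine LowerSemicomputable.of_exists (P := fun _ => True)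
    (PrimrecPred.computablePred (PrimrecPred.of_eq
      (Primrec.eq.comp (Primrec.const 0) (Primrec.const 0)) (by simp))).to_re h2 ?_
  intro σ r _
  rw [bernoulliMixture_real (measurableSet_basicClopen σ),
    lt_integral_iff_exists_lt_sum ν (f := fun q => (bernoulliMu q).real (basicClopen σ))
      (measurable_bernoulliMu_apply (measurableSet_basicClopen σ)).ennreal_toReal
      (fun _ => measureReal_nonneg) fun _ => measureReal_le_one]
  simp only [true_and, List.map_map, Function.comp_def]

theorem mem_MLR_bernoulliMixture (p : unitInterval) (hp : p ∈ MLR ratBall ∅ ν) (x : ℕ → Bool)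
    (hx : x ∈ MLR basicClopen ∅ (bernoulliMu p)) :
    x ∈ MLR basicClopen ∅ (bernoulliMixture ν) := by
  rintro U ⟨⟨W, hW, hU⟩, hμ⟩ hxU
  rw [rePredIn_empty_iff] at hW
  have hdouble : Computable fun i : ℕ => 2 * i := Primrec.nat_double.to_comp
  -- An enumeration of balls that exhaust the parameters `t` with `μ_t (U (2i)) > 2^(-i)`.
  have hP : REPred fun q : (ℕ × (ℕ × ℕ × ℕ)) × List (List Bool) =>
      IsExtensionList (fun σ => W (2 * q.1.1, σ)) q.2 ∧
        ((1 : ℕ) : ℝ) / ((2 ^ q.1.1 : ℕ) : ℝ) < (q.2.map fun τ => ballWeight q.1.2 τ).sum := by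
    refine REPred.and ?_ ?_
    · exact (rePred_isExtensionList hW).comp
        ((hdouble.comp (Computable.fst.comp Computable.fst)).pair Computable.snd)
    · have hlist : Computable fun q : (ℕ × (ℕ × ℕ × ℕ)) × List (List Bool) =>
          q.2.map fun τ => (q.1.2, τ) :=
        (Primrec.list_map Primrec.snd
          ((Primrec.snd.comp (Primrec.fst.comp Primrec.fst)).pair Primrec.snd).to₂).to_comp
      have h1 := (lowerSemicomputable_ballWeight.list_sum fun _ => ballWeight_nonneg _ _).comp hlist
      simp only [List.map_map, Function.comp_def] at h1
      exact h1.rePred_lt (Computable.const 1) (primrec_nat_pow.to_comp.comp (Computable.const 2)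
        (Computable.fst.comp Computable.fst)) fun _ => by positivity
  have hV : ∀ i, {t | ∃ c, (∃ T, IsExtensionList (fun σ => W (2 * i, σ)) T ∧
      ((1 : ℕ) : ℝ) / ((2 ^ i : ℕ) : ℝ) < (T.map fun τ => ballWeight c τ).sum) ∧ t ∈ ratBall c} =
      {t | (2⁻¹ : ENNReal) ^ i < bernoulliMu t (U (2 * i))} := by
    intro i
    ext t
    have h1 := lt_measureReal_cylinder_union_iff (W := fun σ => W (2 * i, σ)) (bernoulliMu t)
      (r := ((1 : ℕ) : ℝ) / ((2 ^ i : ℕ) : ℝ)) (by positivity)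
    have h2 : (2⁻¹ : ENNReal) ^ i = ENNReal.ofReal (((1 : ℕ) : ℝ) / ((2 ^ i : ℕ) : ℝ)) := by
      rw [Nat.cast_one, Nat.cast_pow, one_div, ENNReal.ofReal_inv_of_pos (by positivity),
        ENNReal.ofReal_pow (by positivity), ENNReal.inv_pow]
      simp
    rw [Set.mem_ofPred_eq, Set.mem_ofPred_eq, h2,
      ENNReal.ofReal_lt_iff_lt_toReal (by positivity) (measure_ne_top _ _), hU, ← measureReal_def,
      h1]
    simp only [lt_sum_bernoulliMu_iff]
    constructor
    · rintro ⟨c, ⟨T, hT, hr⟩, ht⟩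
      exact ⟨T, hT, c, hr, ht⟩
    · rintro ⟨T, hT, c, hr, ht⟩
      exact ⟨c, ⟨T, hT, hr⟩, ht⟩
  have hUm : ∀ i, MeasurableSet (U i) := fun i => by
    rw [hU]; exact measurableSet_union_basicClopen _
  obtain ⟨N, hN⟩ := eventually_notMem_of_mem_MLR hp hP.exists (fun i => by
    simp only
    rw [hV i]
    -- Markov's inequality: `2^(-i)` times the measure of the bad parameters is at most `2^(-2i)`.
    -- The index `2i` leaves `2^(-i)` after cancellation.
    have h1 := (mul_meas_ge_le_lintegral (μ := ν) (measurable_bernoulliMu_apply (hUm (2 * i)))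
      ((2⁻¹ : ENNReal) ^ i)).trans ((bernoulliMixture_apply (hUm (2 * i))).symm.le.trans (hμ _))
    have h2 : (2⁻¹ : ENNReal) ^ i ≠ 0 := by simp
    have h3 : (2⁻¹ : ENNReal) ^ i ≠ ⊤ := by simp
    rw [two_mul, pow_add, ENNReal.mul_le_mul_iff_right h2 h3] at h1
    refine le_trans (measure_mono fun t ht => ?_) h1
    simp only [Set.mem_ofPred_eq, ← two_mul] at ht ⊢
    exact ht.le)
  have hN' : ∀ i, N < i → bernoulliMu p (U (2 * i)) ≤ (2⁻¹ : ENNReal) ^ i := by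
    intro i hi
    by_contra! hlt
    have : p ∈ {t | (2⁻¹ : ENNReal) ^ i < bernoulliMu t (U (2 * i))} := hlt
    rw [← hV i] at this
    obtain ⟨c, hc, hpc⟩ := this
    exact hN i hi c hc hpc
  -- The shift skips the finitely many levels at which `p` may be a bad parameter.
  refine hx (fun i => U (2 * (i + (N + 1)))) ⟨⟨fun q => W (2 * (q.1 + (N + 1)), q.2),
    (rePredIn_empty_iff _).2 ?_, fun i => hU _⟩, fun i => ?_⟩ ?_
  · exact hW.comp ((hdouble.comp (Primrec.nat_add.to_comp.comp Computable.fst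
      (Computable.const (N + 1)))).pair Computable.snd)
  · refine (hN' _ (by omega)).trans ?_
    exact pow_le_pow_right_of_le_one' (by simp) (by omega)
  · exact Set.mem_iInter.2 fun i => Set.mem_iInter.1 hxU _

theorem IsProperReal.isProperSeq {p : unitInterval} (hp : IsProperReal p) {x : ℕ → Bool}
    (hx : x ∈ MLR basicClopen ∅ (bernoulliMu p)) : IsProperSeq x := by
  obtain ⟨ν, hν, hc, hpν⟩ := hp
  exact ⟨bernoulliMixture ν, inferInstance,
    isComputableMeasure_of_lowerSemicomputable (lowerSemicomputable_bernoulliMixture hc),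
    mem_MLR_bernoulliMixture p hpν x hx⟩

end Mixture

/-! ### A total, effectively continuous limit of frequencies -/

section Clamp

/-- The number of zeros among the first `8 ^ k` bits of a sequence. -/
def zeroCount (x : ℕ → Bool) (k : ℕ) : ℕ := ((List.range (8 ^ k)).map x).count false

/-- The number of zeros among the first `8 ^ k` bits of a string. -/
def stringZeroCount (σ : List Bool) (k : ℕ) : ℕ := (σ.take (8 ^ k)).count false

theorem zeroCount_le (x : ℕ → Bool) (k : ℕ) : zeroCount x k ≤ 8 ^ k :=
  List.count_le_length.trans_eq (by simp)

theorem stringZeroCount_prefix (x : ℕ → Bool) {n k : ℕ} (h : 8 ^ k ≤ n) :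
    stringZeroCount ((List.range n).map x) k = zeroCount x k := by
  rw [stringZeroCount, zeroCount, ← List.map_take, List.take_range, min_eq_left h]

/-- Consecutive numerators `a / 8 ^ e` and `a' / 8 ^ (e + 1)` differ by at most `2 / 2 ^ e`. -/
def IsClose (e a a' : ℕ) : Prop :=
  a' ≤ 8 * a + 16 * 4 ^ e ∧ 8 * a ≤ a' + 16 * 4 ^ e

instance (e a a' : ℕ) : Decidable (IsClose e a a') := by unfold IsClose; infer_instance

/-- The tolerance `2 / 2^e` allows each frequency an error `1 / 2^e` about a common limit. Over the
denominator `8^(e+1)` it becomes `16 * 4^e`, so closeness is integer arithmetic. -/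
theorem isClose_iff (e a a' : ℕ) :
    IsClose e a a' ↔ |(a : ℝ) / 8 ^ e - (a' : ℝ) / 8 ^ (e + 1)| ≤ 2 / 2 ^ e := by
  have h8 : (0 : ℝ) < 8 ^ (e + 1) := by positivity
  have h42 : (8 : ℝ) ^ e = 4 ^ e * 2 ^ e := by rw [← mul_pow]; norm_num
  have h1 : (a : ℝ) / 8 ^ e - (a' : ℝ) / 8 ^ (e + 1) = (8 * a - a') / 8 ^ (e + 1) := by
    rw [pow_succ]
    field_simp
  have h2 : (2 : ℝ) / 2 ^ e = 16 * 4 ^ e / 8 ^ (e + 1) := by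
    rw [pow_succ, h42]
    field_simp
    norm_num
  rw [h1, h2, abs_div, abs_of_pos h8, div_le_div_iff_of_pos_right h8, abs_le, IsClose]
  constructor
  · rintro ⟨h3, h4⟩
    have h3' : (a' : ℝ) ≤ 8 * a + 16 * 4 ^ e := by exact_mod_cast h3
    have h4' : (8 : ℝ) * a ≤ a' + 16 * 4 ^ e := by exact_mod_cast h4
    constructor <;> linarith
  · rintro ⟨h3, h4⟩
    have h3' : (a' : ℝ) ≤ 8 * a + 16 * 4 ^ e := by linarith
    have h4' : (8 : ℝ) * a ≤ a' + 16 * 4 ^ e := by linarith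
    exact ⟨by exact_mod_cast h3', by exact_mod_cast h4'⟩

/-- The numerators `a K, a (K + 1), …`, except that a numerator too far from its predecessor is
replaced by its predecessor, rescaled. -/
def clampSeq (K : ℕ) (a : ℕ → ℕ) : ℕ → ℕ
  | 0 => a K
  | k + 1 => if IsClose (K + k) (clampSeq K a k) (a (K + k + 1)) then a (K + k + 1)
      else 8 * clampSeq K a k

theorem clampSeq_le {K : ℕ} {a : ℕ → ℕ} (ha : ∀ k, a k ≤ 8 ^ k) (k : ℕ) :
    clampSeq K a k ≤ 8 ^ (K + k) := by
  induction k with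
  | zero => exact ha K
  | succ k ih =>
    rw [clampSeq]
    split_ifs
    · exact ha _
    · rw [← add_assoc, pow_succ]; omega

theorem clampSeq_congr {K : ℕ} {a a' : ℕ → ℕ} {k : ℕ} (h : ∀ j ≤ K + k, a j = a' j) :
    clampSeq K a k = clampSeq K a' k := by
  induction k with
  | zero => exact h K le_rfl
  | succ k ih =>
    rw [clampSeq, clampSeq, ih fun j hj => h j (by omega), h (K + k + 1) (by omega)]

theorem clampSeq_eq {K : ℕ} {a : ℕ → ℕ} (h : ∀ j, K ≤ j → IsClose j (a j) (a (j + 1))) (k : ℕ) :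
    clampSeq K a k = a (K + k) := by
  induction k with
  | zero => rfl
  | succ k ih =>
    rw [clampSeq, ih, if_pos (h _ (by omega))]
    rfl

/-- A rejected numerator is replaced by 8 times its predecessor, which leaves the quotient
unchanged. -/
theorem isClose_clampSeq (K : ℕ) (a : ℕ → ℕ) (k : ℕ) :
    IsClose (K + k) (clampSeq K a k) (clampSeq K a (k + 1)) := by
  rw [clampSeq]
  split_ifs with h
  · exact h
  · exact ⟨by omega, by omega⟩

/-- The clamped frequencies of zeros. -/
noncomputable def clampFreq (K : ℕ) (x : ℕ → Bool) (k : ℕ) : ℝ :=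
  clampSeq K (zeroCount x) k / 8 ^ (K + k)

/-- The bound is `2 / 2^(K+k)`, written as `C / 2 / 2^k` with `C = 4 / 2^K`, so that the distance to
the limit is at most `C / 2^k`. -/
theorem dist_clampFreq_succ_le (K : ℕ) (x : ℕ → Bool) (k : ℕ) :
    dist (clampFreq K x k) (clampFreq K x (k + 1)) ≤ 4 / 2 ^ K / 2 / 2 ^ k := by
  have h := (isClose_iff _ _ _).1 (isClose_clampSeq K (zeroCount x) k)
  rw [Real.dist_eq, clampFreq, clampFreq]
  refine h.trans_eq ?_
  rw [pow_add]
  field_simp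
  norm_num

theorem exists_tendsto_clampFreq (K : ℕ) (x : ℕ → Bool) :
    ∃ l, Tendsto (clampFreq K x) atTop (𝓝 l) :=
  cauchySeq_tendsto_of_complete (cauchySeq_of_le_geometric_two (dist_clampFreq_succ_le K x))

/-- The limit of the clamped frequencies of zeros, as a point of the unit interval. -/
noncomputable def clampLimit (K : ℕ) (x : ℕ → Bool) : unitInterval :=
  ⟨(exists_tendsto_clampFreq K x).choose, by
    refine isClosed_Icc.mem_of_tendsto (exists_tendsto_clampFreq K x).choose_spec
      (Eventually.of_forall fun k => ⟨?_, ?_⟩)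
    · unfold clampFreq; positivity
    · unfold clampFreq
      refine div_le_one_of_le₀ ?_ (by positivity)
      exact_mod_cast clampSeq_le (zeroCount_le x) k⟩

theorem tendsto_clampFreq (K : ℕ) (x : ℕ → Bool) :
    Tendsto (clampFreq K x) atTop (𝓝 (clampLimit K x : ℝ)) :=
  (exists_tendsto_clampFreq K x).choose_spec

theorem abs_clampFreq_sub_le (K : ℕ) (x : ℕ → Bool) (k : ℕ) :
    |clampFreq K x k - clampLimit K x| ≤ 4 / 2 ^ (K + k) := by
  have := dist_le_of_le_geometric_two_of_tendsto (dist_clampFreq_succ_le K x)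
    (tendsto_clampFreq K x) k
  rwa [Real.dist_eq, div_div, ← pow_add] at this

theorem measurable_clampLimit (K : ℕ) : Measurable (clampLimit K) := by
  have hz : ∀ k, Measurable fun x => zeroCount x k := by
    intro k
    have h1 : Measurable fun (x : ℕ → Bool) (i : Fin (8 ^ k)) => x i := by fun_prop
    have h2 : Measurable fun v : Fin (8 ^ k) → Bool => (List.ofFn v).count false :=
      measurable_of_countable _
    convert h2.comp h1 using 2 with x
    rw [zeroCount, Function.comp_apply]
    congr 1
    exact List.ext_getElem (by simp) (by simp)
  have hc : ∀ k, Measurable fun x => clampSeq K (zeroCount x) k := by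
    intro k
    induction k with
    | zero => exact hz K
    | succ k ih =>
      have h2 : Measurable fun v : ℕ × ℕ => if IsClose (K + k) v.1 v.2 then v.2 else 8 * v.1 :=
        measurable_of_countable _
      exact h2.comp (ih.prodMk (hz (K + k + 1)))
  have hf : ∀ k, Measurable fun x => clampFreq K x k := by
    intro k
    have h2 : Measurable fun n : ℕ => (n : ℝ) / 8 ^ (K + k) := measurable_of_countable _
    exact h2.comp (hc k)
  have h3 : Measurable fun x => (clampLimit K x : ℝ) :=
    measurable_of_tendsto_metrizable hf (tendsto_pi_nhds.2 fun x => tendsto_clampFreq K x)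
  exact h3.subtype_mk

/-- The `4 / 2 ^ e`-neighbourhood of `b / 8 ^ e` lies in the interior of the ball coded by `c`. -/
def NearInBall (c : ℕ × ℕ × ℕ) (b e : ℕ) : Prop :=
  b * (c.2.2 + 1) + 4 * 4 ^ e * (c.2.2 + 1) < (c.1 + c.2.1) * 8 ^ e ∧
    c.1 * 8 ^ e + 4 * 4 ^ e * (c.2.2 + 1) < b * (c.2.2 + 1) + c.2.1 * 8 ^ e

theorem nearInBall_iff (c : ℕ × ℕ × ℕ) (b e : ℕ) :
    NearInBall c b e ↔ |(b : ℝ) / 8 ^ e - (c.1 : ℝ) / ((c.2.2 : ℝ) + 1)| + 4 / 2 ^ e <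
      (c.2.1 : ℝ) / ((c.2.2 : ℝ) + 1) := by
  obtain ⟨A, R, d⟩ := c
  have h42 : (8 : ℝ) ^ e = 4 ^ e * 2 ^ e := by rw [← mul_pow]; norm_num
  have hd : (0 : ℝ) < d + 1 := by positivity
  have h8 : (0 : ℝ) < 8 ^ e * (d + 1) := by positivity
  have e1 : (b : ℝ) / 8 ^ e - (A : ℝ) / (d + 1) = (b * (d + 1) - A * 8 ^ e) / (8 ^ e * (d + 1)) := by
    field_simp
  have e2 : (4 : ℝ) / 2 ^ e = 4 * 4 ^ e * (d + 1) / (8 ^ e * (d + 1)) := by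
    rw [h42]; field_simp
  have e3 : (R : ℝ) / (d + 1) = R * 8 ^ e / (8 ^ e * (d + 1)) := by field_simp
  simp only [NearInBall]
  rw [e1, e2, e3, abs_div, abs_of_pos h8, ← add_div, div_lt_div_iff_of_pos_right h8,
    ← lt_sub_iff_add_lt, abs_lt]
  constructor
  · rintro ⟨h3, h4⟩
    have h3' : (b : ℝ) * (d + 1) + 4 * 4 ^ e * (d + 1) < (A + R) * 8 ^ e := by exact_mod_cast h3
    have h4' : (A : ℝ) * 8 ^ e + 4 * 4 ^ e * (d + 1) < b * (d + 1) + R * 8 ^ e := by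
      exact_mod_cast h4
    constructor <;> linarith
  · rintro ⟨h3, h4⟩
    have h3' : (b : ℝ) * (d + 1) + 4 * 4 ^ e * (d + 1) < (A + R) * 8 ^ e := by linarith
    have h4' : (A : ℝ) * 8 ^ e + 4 * 4 ^ e * (d + 1) < b * (d + 1) + R * 8 ^ e := by linarith
    exact ⟨by exact_mod_cast h3', by exact_mod_cast h4'⟩

/-- The cylinder of `σ` is seen to be mapped into the ball coded by `c` by `clampLimit K`. -/
def ClampInBall (K : ℕ) (c : ℕ × ℕ × ℕ) (σ : List Bool) : Prop :=
  ∃ k, σ.length = 8 ^ (K + k) ∧ NearInBall c (clampSeq K (stringZeroCount σ) k) (K + k)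

theorem clampSeq_stringZeroCount {K k : ℕ} (x : ℕ → Bool) :
    clampSeq K (stringZeroCount ((List.range (8 ^ (K + k))).map x)) k =
      clampSeq K (zeroCount x) k :=
  clampSeq_congr fun _ hj => stringZeroCount_prefix x (Nat.pow_le_pow_right (by norm_num) hj)

/-- The first `8^(K+k)` bits fix the limit up to `4 / 2^(K+k)`. A limit in the open ball has a
positive margin, which some stage detects. So preimages of balls are effectively open. -/
theorem clampLimit_mem_ratBall_iff (K : ℕ) (x : ℕ → Bool) (c : ℕ × ℕ × ℕ) :
    clampLimit K x ∈ ratBall c ↔ ∃ σ, ClampInBall K c σ ∧ x ∈ basicClopen σ := by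
  have key : (∃ σ, ClampInBall K c σ ∧ x ∈ basicClopen σ) ↔
      ∃ k, NearInBall c (clampSeq K (zeroCount x) k) (K + k) := by
    constructor
    · rintro ⟨σ, ⟨k, hk, h⟩, hx⟩
      rw [mem_basicClopen_iff, hk] at hx
      rw [← hx, clampSeq_stringZeroCount] at h
      exact ⟨k, h⟩
    · rintro ⟨k, h⟩
      refine ⟨(List.range (8 ^ (K + k))).map x, ⟨k, by simp, ?_⟩, ?_⟩
      · rwa [clampSeq_stringZeroCount]
      · rw [mem_basicClopen_iff]; simp
  rw [key]
  simp only [nearInBall_iff, ratBall, Set.mem_ofPred_eq]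
  constructor
  · intro h
    have h1 : Tendsto (fun k => |clampFreq K x k - (c.1 : ℝ) / ((c.2.2 : ℝ) + 1)| +
        4 * ((1 / 2) ^ K * (1 / 2) ^ k)) atTop
        (𝓝 (|(clampLimit K x : ℝ) - (c.1 : ℝ) / ((c.2.2 : ℝ) + 1)| + 4 * ((1 / 2) ^ K * 0))) :=
      ((tendsto_clampFreq K x).sub_const _).abs.add (((tendsto_pow_atTop_nhds_zero_of_lt_one
        (by norm_num) (by norm_num)).const_mul _).const_mul _)
    rw [mul_zero, mul_zero, add_zero] at h1
    obtain ⟨k, hk⟩ := (h1.eventually_lt_const h).exists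
    refine ⟨k, ?_⟩
    rwa [← pow_add, one_div_pow, mul_one_div] at hk
  · rintro ⟨k, hk⟩
    have h1 := abs_clampFreq_sub_le K x k
    rw [abs_sub_comm] at h1
    have h2 := abs_sub_le (clampLimit K x : ℝ) (clampFreq K x k) ((c.1 : ℝ) / ((c.2.2 : ℝ) + 1))
    unfold clampFreq at h1 h2
    linarith

theorem primrec_stringZeroCount : Primrec₂ stringZeroCount :=
  (primrec_count false).comp (Primrec.list_take.comp
    (primrec_nat_pow.comp (Primrec.const 8) Primrec.snd) Primrec.fst)

theorem primrecPred_isClose {α : Type*} [Primcodable α] {f g h : α → ℕ} (hf : Primrec f)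
    (hg : Primrec g) (hh : Primrec h) : PrimrecPred fun a => IsClose (f a) (g a) (h a) := by
  have h1 : Primrec fun a => 16 * 4 ^ f a :=
    Primrec.nat_mul.comp (Primrec.const 16) (primrec_nat_pow.comp (Primrec.const 4) hf)
  have h2 : Primrec fun a => 8 * g a := Primrec.nat_mul.comp (Primrec.const 8) hg
  exact (Primrec.nat_le.comp hh (Primrec.nat_add.comp h2 h1)).and
    (Primrec.nat_le.comp h2 (Primrec.nat_add.comp hh h1))

theorem primrec_clampSeq (K : ℕ) :
    Primrec₂ fun (σ : List Bool) (k : ℕ) => clampSeq K (stringZeroCount σ) k := by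
  have hidx : Primrec fun q : (List Bool × ℕ) × (ℕ × ℕ) => K + q.2.1 :=
    Primrec.nat_add.comp (Primrec.const K) (Primrec.fst.comp Primrec.snd)
  have hnext : Primrec fun q : (List Bool × ℕ) × (ℕ × ℕ) =>
      stringZeroCount q.1.1 (K + q.2.1 + 1) :=
    primrec_stringZeroCount.comp (Primrec.fst.comp Primrec.fst) (Primrec.succ.comp hidx)
  have hprev : Primrec fun q : (List Bool × ℕ) × (ℕ × ℕ) => q.2.2 := Primrec.snd.comp Primrec.snd
  refine (Primrec.nat_rec' (f := fun q : List Bool × ℕ => q.2)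
    (g := fun q => stringZeroCount q.1 K)
    (h := fun q r => if IsClose (K + r.1) r.2 (stringZeroCount q.1 (K + r.1 + 1)) then
      stringZeroCount q.1 (K + r.1 + 1) else 8 * r.2) Primrec.snd
    (primrec_stringZeroCount.comp Primrec.fst (Primrec.const K))
    (Primrec.ite (primrecPred_isClose hidx hprev hnext) hnext
      (Primrec.nat_mul.comp (Primrec.const 8) hprev))).of_eq ?_
  rintro ⟨σ, k⟩
  simp only
  induction k with
  | zero => rfl
  | succ k ih => rw [clampSeq, ← ih]

theorem rePred_clampInBall (K : ℕ) :
    REPred fun q : (ℕ × ℕ × ℕ) × List Bool => ClampInBall K q.1 q.2 := by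
  have hσ : Primrec fun q : ((ℕ × ℕ × ℕ) × List Bool) × ℕ => q.1.2 :=
    Primrec.snd.comp Primrec.fst
  have hA : Primrec fun q : ((ℕ × ℕ × ℕ) × List Bool) × ℕ => q.1.1.1 :=
    Primrec.fst.comp (Primrec.fst.comp Primrec.fst)
  have hR : Primrec fun q : ((ℕ × ℕ × ℕ) × List Bool) × ℕ => q.1.1.2.1 :=
    Primrec.fst.comp (Primrec.snd.comp (Primrec.fst.comp Primrec.fst))
  have hd : Primrec fun q : ((ℕ × ℕ × ℕ) × List Bool) × ℕ => q.1.1.2.2 + 1 :=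
    Primrec.succ.comp (Primrec.snd.comp (Primrec.snd.comp (Primrec.fst.comp Primrec.fst)))
  have he : Primrec fun q : ((ℕ × ℕ × ℕ) × List Bool) × ℕ => K + q.2 :=
    Primrec.nat_add.comp (Primrec.const K) Primrec.snd
  have h8 := primrec_nat_pow.comp (Primrec.const 8) he
  have hb := Primrec.nat_mul.comp ((primrec_clampSeq K).comp hσ Primrec.snd) hd
  have hε := Primrec.nat_mul.comp (Primrec.nat_mul.comp (Primrec.const 4)
    (primrec_nat_pow.comp (Primrec.const 4) he)) hd
  have h1 := Primrec.eq.comp (Primrec.list_length.comp hσ) h8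
  have h2 := (Primrec.nat_lt.comp (Primrec.nat_add.comp hb hε)
    (Primrec.nat_mul.comp (Primrec.nat_add.comp hA hR) h8)).and
    (Primrec.nat_lt.comp (Primrec.nat_add.comp (Primrec.nat_mul.comp hA h8) hε)
      (Primrec.nat_add.comp hb (Primrec.nat_mul.comp hR h8)))
  have h3 : PrimrecPred fun q : ((ℕ × ℕ × ℕ) × List Bool) × ℕ => q.1.2.length = 8 ^ (K + q.2) ∧
      NearInBall q.1.1 (clampSeq K (stringZeroCount q.1.2) q.2) (K + q.2) := h1.and h2
  exact h3.computablePred.to_re.exists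

end Clamp

/-! ### Image measures and preservation of randomness -/

section Pushforward

theorem clampLimit_preimage (K : ℕ) (P : ℕ × ℕ × ℕ → Prop) :
    clampLimit K ⁻¹' {t | ∃ c, P c ∧ t ∈ ratBall c} =
      {x | ∃ σ, (∃ c, P c ∧ ClampInBall K c σ) ∧ x ∈ basicClopen σ} := by
  ext x
  simp only [Set.mem_preimage, Set.mem_ofPred_eq, clampLimit_mem_ratBall_iff]
  constructor
  · rintro ⟨c, hc, σ, hσ, hx⟩
    exact ⟨σ, ⟨c, hc, hσ⟩, hx⟩
  · rintro ⟨σ, ⟨c, hc, hσ⟩, hx⟩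
    exact ⟨c, hc, σ, hσ, hx⟩

theorem rePred_exists_clampInBall {α : Type*} [Primcodable α] (K : ℕ)
    {W : α × (ℕ × ℕ × ℕ) → Prop} (hW : REPred W) :
    REPred fun q : α × List Bool => ∃ c, W (q.1, c) ∧ ClampInBall K c q.2 := by
  have h1 : REPred fun q : (α × List Bool) × (ℕ × ℕ × ℕ) =>
      W (q.1.1, q.2) ∧ ClampInBall K q.2 q.1.2 :=
    (hW.comp ((Computable.fst.comp Computable.fst).pair Computable.snd)).and
      ((rePred_clampInBall K).comp (Computable.snd.pair (Computable.snd.comp Computable.fst)))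
  exact h1.exists

theorem isComputableMeasureUnit_map_clampLimit (K : ℕ) {μ : Measure (ℕ → Bool)}
    [IsProbabilityMeasure μ] (hμ : IsComputableMeasure μ) :
    IsComputableMeasureUnit (μ.map (clampLimit K)) := by
  have hmem : REPred fun q : List (ℕ × ℕ × ℕ) × (ℕ × ℕ × ℕ) => q.2 ∈ q.1 :=
    PrimrecPred.computablePred (PrimrecPred.of_eq
      (PrimrecRel.comp (PrimrecRel.exists_mem_list (Primrec.eq (α := ℕ × ℕ × ℕ)))
        Primrec.fst Primrec.snd) fun q => by simp) |>.to_re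
  have h1 := hμ.lowerSemicomputable.measure_cylinder_union (rePred_exists_clampInBall K hmem)
  have h2 : LowerSemicomputable fun L : List (ℕ × ℕ × ℕ) =>
      (μ.map (clampLimit K)).real {t | ∃ c ∈ L, t ∈ ratBall c} := by
    convert h1 using 2 with L
    rw [map_measureReal_apply (measurable_clampLimit K) (measurableSet_union_ratBall _),
      clampLimit_preimage]
  exact h2

/-- The preimage of a test for the image measure is a test for `μ`, with the same measures. -/
theorem clampLimit_mem_MLR (K : ℕ) {μ : Measure (ℕ → Bool)} {x : ℕ → Bool}
    (hx : x ∈ MLR basicClopen ∅ μ) : clampLimit K x ∈ MLR ratBall ∅ (μ.map (clampLimit K)) := by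
  rintro U ⟨⟨W, hW, hU⟩, hμ⟩ hxU
  rw [rePredIn_empty_iff] at hW
  refine hx (fun i => clampLimit K ⁻¹' U i) ⟨⟨_, (rePredIn_empty_iff _).2
    (rePred_exists_clampInBall K hW), fun i => ?_⟩, fun i => ?_⟩ ?_
  · simp only [hU]
    exact clampLimit_preimage K fun c => W (i, c)
  · rw [← Measure.map_apply (measurable_clampLimit K)]
    · exact hμ i
    · rw [hU]; exact measurableSet_union_ratBall _
  · exact Set.mem_iInter.2 fun i => Set.mem_iInter.1 hxU i

end Pushforward

/-! ### The effective law of large numbers -/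

section LawOfLargeNumbers

theorem zeroCount_eq_sum (x : ℕ → Bool) (k : ℕ) :
    (zeroCount x k : ℝ) = ∑ i ∈ Finset.range (8 ^ k), if x i = false then (1 : ℝ) else 0 := by
  rw [zeroCount]
  generalize 8 ^ k = n
  induction n with
  | zero => simp
  | succ n ih =>
    rw [List.range_succ, List.map_append, List.count_append, Finset.sum_range_succ, ← ih]
    cases h : x n <;> simp [h]

/-- Chebyshev's inequality for `8^k` independent indicators, each of variance at most `1/4`.
Sampling at `8^k` makes the bound geometric even for `ε = 2^(-k)`, where it is `2^(-k) / 4`. -/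
theorem bernoulliMu_zeroCount_deviation_le (p : unitInterval) (k : ℕ) {ε : ℝ} (hε : 0 < ε) :
    bernoulliMu p {x | ε ≤ |(zeroCount x k : ℝ) / 8 ^ k - p|} ≤
      ENNReal.ofReal (1 / (4 * 8 ^ k * ε ^ 2)) := by
  let g : Bool → ℝ := fun b => if b = false then 1 else 0
  let X : ℕ → (ℕ → Bool) → ℝ := fun i x => g (x i)
  have hgm : Measurable g := measurable_of_countable _
  have hXm : ∀ i, Measurable (X i) := fun i => hgm.comp (measurable_pi_apply i)
  have hX01 : ∀ i x, X i x ∈ Set.Icc (0 : ℝ) 1 := by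
    intro i x
    simp only [X, g]
    split_ifs <;> simp
  have hXL : ∀ i, MemLp (X i) 2 (bernoulliMu p) := fun i =>
    MemLp.of_bound (hXm i).aestronglyMeasurable 1 (ae_of_all _ fun x => by
      rw [Real.norm_eq_abs, abs_of_nonneg (hX01 i x).1]; exact (hX01 i x).2)
  have hind : iIndepFun X (bernoulliMu p) := by
    unfold bernoulliMu
    exact iIndepFun_infinitePi (P := fun _ : ℕ => bernoulliMeasure false true p)
      (X := fun _ => g) fun _ => hgm
  have hmean : ∀ i, ∫ x, X i x ∂(bernoulliMu p) = p := by
    intro i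
    have h1 : (bernoulliMu p).map (fun x => x i) = bernoulliMeasure false true p :=
      Measure.infinitePi_map_eval (fun _ : ℕ => bernoulliMeasure false true p) i
    have h2 := integral_map (μ := bernoulliMu p) (measurable_pi_apply i).aemeasurable
      (f := g) hgm.aestronglyMeasurable
    rw [h1, integral_bernoulliMeasure] at h2
    rw [← h2]
    simp [g]
  have hvar : ∀ i, Var[X i; bernoulliMu p] ≤ 1 / 4 := fun i =>
    (variance_le_sq_of_bounded (ae_of_all _ fun x => hX01 i x) (hXm i).aemeasurable).trans_eq
      (by norm_num)
  set n : ℕ := 8 ^ k with hn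
  have hnpos : (0 : ℝ) < n := by rw [hn]; positivity
  have hS : ∀ x, (zeroCount x k : ℝ) = (∑ i ∈ Finset.range n, X i) x := fun x => by
    rw [zeroCount_eq_sum, Finset.sum_apply]
  have hSmean : ∫ x, (∑ i ∈ Finset.range n, X i) x ∂(bernoulliMu p) = n * p := by
    simp only [Finset.sum_apply]
    rw [integral_finsetSum _ fun i _ => (hXL i).integrable one_le_two]
    simp [hmean]
  have hSvar : Var[∑ i ∈ Finset.range n, X i; bernoulliMu p] ≤ n / 4 := by
    rw [IndepFun.variance_sum (fun i _ => hXL i) fun i _ j _ hij => hind.indepFun hij]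
    refine (Finset.sum_le_sum fun i _ => hvar i).trans_eq ?_
    rw [Finset.sum_const, Finset.card_range, nsmul_eq_mul, mul_one_div]
  have hcheb := meas_ge_le_variance_div_sq (memLp_finsetSum' (Finset.range n) fun i _ => hXL i)
    (mul_pos hε hnpos)
  have hn8 : (8 : ℝ) ^ k = n := by rw [hn]; push_cast; rfl
  rw [hSmean] at hcheb
  refine le_trans (le_of_eq ?_) (hcheb.trans (ENNReal.ofReal_le_ofReal ?_))
  · congr 1
    ext x
    simp only [Set.mem_ofPred_eq]
    rw [hn8, ← hS, ← mul_le_mul_iff_left₀ hnpos, ← abs_of_pos hnpos, ← abs_mul, abs_of_pos hnpos,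
      sub_mul, div_mul_cancel₀ _ hnpos.ne', mul_comm (p : ℝ)]
  · rw [hn8, div_le_div_iff₀ (by positivity) (by positivity)]
    have := mul_le_mul_of_nonneg_right hSvar (by positivity : 0 ≤ 4 * (n : ℝ) * ε ^ 2)
    nlinarith

theorem ofReal_one_div_two_pow (i : ℕ) :
    ENNReal.ofReal (1 / 2 ^ i) = (2⁻¹ : ENNReal) ^ i := by
  rw [one_div, ENNReal.ofReal_inv_of_pos (by positivity), ENNReal.ofReal_pow (by positivity),
    ENNReal.inv_pow]
  simp

/-- The union of the cylinders of the strings of length `n` with a property. -/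
theorem union_cylinders_length_eq (n : ℕ) (P : List Bool → Prop) :
    {x | ∃ σ, (σ.length = n ∧ P σ) ∧ x ∈ basicClopen σ} = {x | P ((List.range n).map x)} := by
  ext x
  simp only [Set.mem_ofPred_eq, mem_basicClopen_iff]
  constructor
  · rintro ⟨σ, ⟨rfl, h⟩, hx⟩
    rwa [hx]
  · exact fun h => ⟨_, ⟨by simp, h⟩, by simp⟩

variable {p : unitInterval} {x : ℕ → Bool}

theorem eventually_not_of_mem_MLR_bernoulliMu (hx : x ∈ MLR basicClopen ∅ (bernoulliMu p))
    {n : ℕ → ℕ} (hn : Primrec n) {P : ℕ → List Bool → Prop} (hP : PrimrecRel P)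
    (hμ : ∀ i, bernoulliMu p {y | P i ((List.range (n i)).map y)} ≤ (2⁻¹ : ENNReal) ^ i) :
    ∃ N, ∀ i, N < i → ¬ P i ((List.range (n i)).map x) := by
  have hW : REPred fun q : ℕ × List Bool => q.2.length = n q.1 ∧ P q.1 q.2 :=
    ((Primrec.eq.comp (Primrec.list_length.comp Primrec.snd) (hn.comp Primrec.fst)).and
      (hP.comp Primrec.fst Primrec.snd)).computablePred.to_re
  obtain ⟨N, hN⟩ := eventually_notMem_of_mem_MLR hx hW fun i => by
    simp only [union_cylinders_length_eq]
    exact hμ i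
  exact ⟨N, fun i hi h => hN i hi _ ⟨by simp, h⟩ (by rw [mem_basicClopen_iff]; simp)⟩

/-- Comparing consecutive frequencies with each other, and not with `p`, keeps the test free of `p`,
so it needs no oracle. A violation forces one of the two to deviate from `p` by at least `1 / 2^j`.
-/
theorem exists_forall_isClose_zeroCount (hx : x ∈ MLR basicClopen ∅ (bernoulliMu p)) :
    ∃ K, ∀ j, K ≤ j → IsClose j (zeroCount x j) (zeroCount x (j + 1)) := by
  have hn : Primrec fun j : ℕ => 8 ^ (j + 1) :=
    primrec_nat_pow.comp (Primrec.const 8) Primrec.succ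
  have hP : PrimrecRel fun (j : ℕ) (σ : List Bool) =>
      ¬ IsClose j (stringZeroCount σ j) (stringZeroCount σ (j + 1)) :=
    (primrecPred_isClose Primrec.fst (primrec_stringZeroCount.comp Primrec.snd Primrec.fst)
      (primrec_stringZeroCount.comp Primrec.snd (Primrec.succ.comp Primrec.fst))).not.primrecRel
  have hz : ∀ (j : ℕ) (y : ℕ → Bool),
      stringZeroCount ((List.range (8 ^ (j + 1))).map y) j = zeroCount y j ∧
      stringZeroCount ((List.range (8 ^ (j + 1))).map y) (j + 1) = zeroCount y (j + 1) :=
    fun j y => ⟨stringZeroCount_prefix y (Nat.pow_le_pow_right (by norm_num) (by omega)),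
      stringZeroCount_prefix y le_rfl⟩
  obtain ⟨N, hN⟩ := eventually_not_of_mem_MLR_bernoulliMu hx hn hP fun j => by
    simp only [(hz j _).1, (hz j _).2]
    have hsub : {y | ¬ IsClose j (zeroCount y j) (zeroCount y (j + 1))} ⊆
        {y | (1 : ℝ) / 2 ^ j ≤ |(zeroCount y j : ℝ) / 8 ^ j - p|} ∪
        {y | (1 : ℝ) / 2 ^ j ≤ |(zeroCount y (j + 1) : ℝ) / 8 ^ (j + 1) - p|} := by
      intro y hy
      simp only [Set.mem_ofPred_eq, Set.mem_union] at hy ⊢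
      by_contra! hcon
      apply hy
      rw [isClose_iff]
      have h1 := abs_sub_le ((zeroCount y j : ℝ) / 8 ^ j) p ((zeroCount y (j + 1) : ℝ) / 8 ^ (j + 1))
      rw [abs_sub_comm (p : ℝ)] at h1
      have h2 : (2 : ℝ) / 2 ^ j = 1 / 2 ^ j + 1 / 2 ^ j := by ring
      linarith [hcon.1, hcon.2]
    have hpos : (0 : ℝ) < 1 / 2 ^ j := by positivity
    have h8 : (8 : ℝ) ^ j = 2 ^ j * 2 ^ j * 2 ^ j := by rw [← mul_pow, ← mul_pow]; norm_num
    calc bernoulliMu p {y | ¬ IsClose j (zeroCount y j) (zeroCount y (j + 1))}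
        ≤ _ := measure_mono hsub
      _ ≤ _ := measure_union_le _ _
      _ ≤ ENNReal.ofReal (1 / (4 * 8 ^ j * (1 / 2 ^ j) ^ 2)) +
          ENNReal.ofReal (1 / (4 * 8 ^ (j + 1) * (1 / 2 ^ j) ^ 2)) :=
        add_le_add (bernoulliMu_zeroCount_deviation_le p j hpos)
          (bernoulliMu_zeroCount_deviation_le p (j + 1) hpos)
      _ ≤ ENNReal.ofReal (1 / 2 ^ j) := by
        rw [← ENNReal.ofReal_add (by positivity) (by positivity)]
        -- The two deviation bounds are `1/4` and `1/32` of `1 / 2^j`.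
        refine ENNReal.ofReal_le_ofReal ?_
        have e1 : (1 : ℝ) / (4 * 8 ^ j * (1 / 2 ^ j) ^ 2) = 1 / 4 * (1 / 2 ^ j) := by
          rw [h8]; field_simp
        have e2 : (1 : ℝ) / (4 * 8 ^ (j + 1) * (1 / 2 ^ j) ^ 2) = 1 / 32 * (1 / 2 ^ j) := by
          rw [pow_succ, h8]; field_simp; norm_num
        rw [e1, e2]
        linarith
      _ = _ := ofReal_one_div_two_pow j
  refine ⟨N + 1, fun j hj => ?_⟩
  have := hN j (by omega)
  rwa [(hz j x).1, (hz j x).2, not_not] at this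

/-- The rational `b / 8 ^ e` lies in the ball coded by `c`. -/
def FracInBall (c : ℕ × ℕ × ℕ) (b e : ℕ) : Prop :=
  b * (c.2.2 + 1) < (c.1 + c.2.1) * 8 ^ e ∧ c.1 * 8 ^ e < b * (c.2.2 + 1) + c.2.1 * 8 ^ e

theorem fracInBall_iff (c : ℕ × ℕ × ℕ) (b e : ℕ) :
    FracInBall c b e ↔ |(b : ℝ) / 8 ^ e - (c.1 : ℝ) / ((c.2.2 : ℝ) + 1)| <
      (c.2.1 : ℝ) / ((c.2.2 : ℝ) + 1) := by
  obtain ⟨A, R, d⟩ := c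
  have hd : (0 : ℝ) < d + 1 := by positivity
  have h8 : (0 : ℝ) < 8 ^ e * (d + 1) := by positivity
  have e1 : (b : ℝ) / 8 ^ e - (A : ℝ) / (d + 1) = (b * (d + 1) - A * 8 ^ e) / (8 ^ e * (d + 1)) := by
    field_simp
  have e3 : (R : ℝ) / (d + 1) = R * 8 ^ e / (8 ^ e * (d + 1)) := by field_simp
  simp only [FracInBall]
  rw [e1, e3, abs_div, abs_of_pos h8, div_lt_div_iff_of_pos_right h8, abs_lt]
  constructor
  · rintro ⟨h3, h4⟩
    have h3' : (b : ℝ) * (d + 1) < (A + R) * 8 ^ e := by exact_mod_cast h3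
    have h4' : (A : ℝ) * 8 ^ e < b * (d + 1) + R * 8 ^ e := by exact_mod_cast h4
    constructor <;> linarith
  · rintro ⟨h3, h4⟩
    have h3' : (b : ℝ) * (d + 1) < (A + R) * 8 ^ e := by linarith
    have h4' : (A : ℝ) * 8 ^ e < b * (d + 1) + R * 8 ^ e := by linarith
    exact ⟨by exact_mod_cast h3', by exact_mod_cast h4'⟩

/-- The test refers to `p` only through one fixed rational ball, hence through finitely many
constants. -/
theorem eventually_zeroCount_mem_ball (hx : x ∈ MLR basicClopen ∅ (bernoulliMu p))
    {c : ℕ × ℕ × ℕ} (hc : p ∈ ratBall c) :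
    ∃ N, ∀ k, N < k → FracInBall c (zeroCount x k) k := by
  simp only [ratBall, Set.mem_ofPred_eq] at hc
  set ε := (c.2.1 : ℝ) / ((c.2.2 : ℝ) + 1) - |(p : ℝ) - (c.1 : ℝ) / ((c.2.2 : ℝ) + 1)| with hεdef
  have hε : 0 < ε := by rw [hεdef]; linarith
  -- The delay `M` absorbs the constant `ε`: since `8^M * ε^2 > 1`, the deviation bound at stage `i
  -- + M` is below `2^(-i)`.
  obtain ⟨M, hM⟩ := pow_unbounded_of_one_lt (1 / ε ^ 2) (by norm_num : (1 : ℝ) < 8)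
  have he : Primrec fun i : ℕ => i + M := Primrec.nat_add.comp Primrec.id (Primrec.const M)
  have hP : PrimrecRel fun (i : ℕ) (σ : List Bool) =>
      ¬ FracInBall c (stringZeroCount σ (i + M)) (i + M) := by
    have he' : Primrec fun q : ℕ × List Bool => q.1 + M := he.comp Primrec.fst
    have hb := Primrec.nat_mul.comp (primrec_stringZeroCount.comp Primrec.snd he')
      (Primrec.const (c.2.2 + 1))
    have h8 := primrec_nat_pow.comp (Primrec.const 8) he'
    exact ((Primrec.nat_lt.comp hb (Primrec.nat_mul.comp (Primrec.const (c.1 + c.2.1)) h8)).and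
      (Primrec.nat_lt.comp (Primrec.nat_mul.comp (Primrec.const c.1) h8)
        (Primrec.nat_add.comp hb (Primrec.nat_mul.comp (Primrec.const c.2.1) h8)))).not.primrecRel
  obtain ⟨N, hN⟩ := eventually_not_of_mem_MLR_bernoulliMu hx
    (primrec_nat_pow.comp (Primrec.const 8) he) hP fun i => by
    simp only [stringZeroCount_prefix _ le_rfl]
    rw [← ofReal_one_div_two_pow]
    refine le_trans (measure_mono ?_) ((bernoulliMu_zeroCount_deviation_le p (i + M) hε).trans
      (ENNReal.ofReal_le_ofReal ?_))
    · intro y hy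
      simp only [Set.mem_ofPred_eq, fracInBall_iff, not_lt] at hy ⊢
      have := abs_sub_le ((zeroCount y (i + M) : ℝ) / 8 ^ (i + M)) p
        ((c.1 : ℝ) / ((c.2.2 : ℝ) + 1))
      rw [hεdef]
      linarith
    · refine one_div_le_one_div_of_le (by positivity) ?_
      have h1 : (1 : ℝ) ≤ 8 ^ M * ε ^ 2 := ((div_lt_iff₀ (by positivity)).1 hM).le
      have h2 : (2 : ℝ) ^ i ≤ 8 ^ i := pow_le_pow_left₀ (by norm_num) (by norm_num) i
      have h3 : (0 : ℝ) < 8 ^ i := by positivity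
      rw [pow_add]
      nlinarith
  refine ⟨N + M, fun k hk => ?_⟩
  have := hN (k - M) (by omega)
  rwa [stringZeroCount_prefix _ le_rfl, show k - M + M = k by omega, not_not] at this

theorem tendsto_zeroCount_div (hx : x ∈ MLR basicClopen ∅ (bernoulliMu p)) :
    Tendsto (fun k => (zeroCount x k : ℝ) / 8 ^ k) atTop (𝓝 (p : ℝ)) := by
  rw [Metric.tendsto_atTop]
  intro ε hε
  -- The ball has radius `2 / (n + 1) < ε / 2` and contains both `p` and the frequency.
  obtain ⟨n, hn⟩ := exists_nat_one_div_lt (show 0 < ε / 4 by positivity)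
  have hp := mem_ratBall_floor p n
  obtain ⟨N, hN⟩ := eventually_zeroCount_mem_ball hx hp
  refine ⟨N + 1, fun k hk => ?_⟩
  have h1 := (fracInBall_iff _ _ _).1 (hN k (by omega))
  simp only [ratBall, Set.mem_ofPred_eq] at hp h1
  rw [Real.dist_eq]
  have h2 := abs_sub_le ((zeroCount x k : ℝ) / 8 ^ k) ((⌊(p : ℝ) * (n + 1)⌋₊ : ℝ) / (n + 1)) p
  rw [abs_sub_comm (p : ℝ)] at hp
  have h3 : ((2 : ℕ) : ℝ) / ((n : ℝ) + 1) = 2 * (1 / ((n : ℝ) + 1)) := by push_cast; ring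
  rw [h3] at hp h1
  linarith

/-- From `K` on nothing is overridden, so the clamped frequencies of `x` are its true ones. The
integer `K` depends on `x`, but any fixed `K` gives a computable map. -/
theorem exists_clampLimit_eq (hx : x ∈ MLR basicClopen ∅ (bernoulliMu p)) :
    ∃ K, clampLimit K x = p := by
  obtain ⟨K, hK⟩ := exists_forall_isClose_zeroCount hx
  refine ⟨K, Subtype.ext (tendsto_nhds_unique (tendsto_clampFreq K x) ?_)⟩
  have h1 := (tendsto_zeroCount_div hx).comp (tendsto_add_atTop_nat K)
  refine h1.congr fun k => ?_
  simp only [Function.comp_apply, clampFreq]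
  rw [clampSeq_eq hK, add_comm k K]

end LawOfLargeNumbers

/-! ### From `x` to `p`, and the equivalence -/

theorem IsProperSeq.isProperReal {p : unitInterval} {x : ℕ → Bool} (h : IsProperSeq x)
    (hx : x ∈ MLR basicClopen ∅ (bernoulliMu p)) : IsProperReal p := by
  obtain ⟨μ, hμ, hc, hxμ⟩ := h
  obtain ⟨K, rfl⟩ := exists_clampLimit_eq hx
  exact ⟨μ.map (clampLimit K), Measure.isProbabilityMeasure_map (measurable_clampLimit K).aemeasurable,
    isComputableMeasureUnit_map_clampLimit K hc, clampLimit_mem_MLR K hxμ⟩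

end AlgRandom

theorem corollary3p6 (p : unitInterval) (x : ℕ → Bool) (hx : x ∈ AlgRandom.bernoulliMLR p) :
    AlgRandom.IsProperSeq x ↔ AlgRandom.IsProperReal p := by
  have hx' := AlgRandom.MLR_subset_MLR_empty _ _ hx
  exact ⟨fun h => h.isProperReal hx', fun h => h.isProperSeq hx'⟩
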